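/- Let $B>0$ and let $\mathcal F$ be the set of probability distributions on $\mathbb R$ with support contained in $[0,B]$; write $m(G)$ for the mean of $G\in\mathcal F$. For $F\in\mathcal F$ and $u\in[0,B]$ let $$\mathcal K^+(F,u)=\inf\{\mathrm{KL}(F,G): G\in\mathcal F,\ m(G)>u\},\qquad \mathcal K^-(F,u)=\inf\{\mathrm{KL}(F,G): G\in\mathcal F,\ m(G)<u\},$$ with $\inf\emptyset=+\infty$ and $0\cdot\infty=0$. Let $K\ge 2$ and let $\boldsymbol F=(F_1,\dots,F_K)\in\mathcal F^K$ with $m(F_i)\in(0,B)$ for all $i$, having a unique arm $i^\star$ of largest mean. Let $\Delta_K=\{w\in[0,1]^K:\sum_i w_i=1\}$ be the probability simplex. For $w\in\Delta_K$ and $i\ne i^\star$ define the transportation cost $$C_i(w)=\inf_{u\in[0,B]}\{w_{i^\star}\mathcal K^-(F_{i^\star},u)+w_i\,\mathcal K^+(F_i,u)\},$$ and, for $\beta\in(0,1)$, put $$T^\star(\boldsymbol F)^{-1}=\sup_{w\in\Delta_K}\min_{i\neq i^\star}C_i(w),\qquad T_\beta^\star(\boldsymbol F)^{-1}=\sup_{w\in\Delta_K,\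 w_{i^\star}=\beta}\ \min_{i\neq i^\star}C_i(w),$$ with sets of maximizers $w^\star(\boldsymbol F)$ and $w^\star_\beta(\boldsymbol F)$ respectively. Then: 1. $w^\star(\boldsymbol F)$ consists of exactly one allocation $w$, and $C_i(w)=T^\star(\boldsymbol F)^{-1}$ for all $i\neq i^\star$. 2. If in addition no suboptimal arm is deterministic (that is, for $i\ne i^\star$, $F_i$ is not a point mass), then for every $\beta\in(0,1)$ the set $w_\beta^\star(\boldsymbol F)$ consists of exactly one allocation $w$, and $C_i(w)=T_\beta^\star(\boldsymbol F)^{-1}$ for all $i\ne i^\star$. -/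

import Mathlib

open MeasureTheory InformationTheory
open scoped ENNReal

namespace BestArm

noncomputable section

/-- The mean `m(F) = E_{X ∼ F}[X]` of a probability distribution on `ℝ`. -/
def mean (F : ProbabilityMeasure ℝ) : ℝ := ∫ x, x ∂(F : Measure ℝ)

/-- The class of probability distributions on `ℝ` with support in `[0, B]`. -/
def boundedClass (B : ℝ) : Set (ProbabilityMeasure ℝ) :=
  {F | (F : Measure ℝ).support ⊆ Set.Icc 0 B}

/-- `K_inf⁺(F, u) = inf {KL(F, G) | G ∈ 𝓕, m(G) > u}`, with `inf ∅ = ∞`. -/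
def KinfPlus (𝓕 : Set (ProbabilityMeasure ℝ)) (F : ProbabilityMeasure ℝ) (u : ℝ) : ℝ≥0∞ :=
  ⨅ G ∈ {G | G ∈ 𝓕 ∧ u < mean G}, klDiv (F : Measure ℝ) (G : Measure ℝ)

/-- `K_inf⁻(F, u) = inf {KL(F, G) | G ∈ 𝓕, m(G) < u}`, with `inf ∅ = ∞`. -/
def KinfMinus (𝓕 : Set (ProbabilityMeasure ℝ)) (F : ProbabilityMeasure ℝ) (u : ℝ) : ℝ≥0∞ :=
  ⨅ G ∈ {G | G ∈ 𝓕 ∧ mean G < u}, klDiv (F : Measure ℝ) (G : Measure ℝ)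

variable {K : ℕ}

/-- The set `i⋆(F)` of arms with the largest mean. -/
def bestArms (F : Fin K → ProbabilityMeasure ℝ) : Set (Fin K) :=
  {i | ∀ j, mean (F j) ≤ mean (F i)}

/-- The transportation cost
`C_{i,j}(F, w) = inf_{u ∈ [0,B]} {w_i K_inf⁻(F_i, u) + w_j K_inf⁺(F_j, u)}`
for the class of distributions supported in `[0, B]`. -/
def transportCost (B : ℝ) (F : Fin K → ProbabilityMeasure ℝ) (w : Fin K → ℝ) (i j : Fin K) :
    ℝ≥0∞ :=
  ⨅ u ∈ Set.Icc (0 : ℝ) B,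
    (ENNReal.ofReal (w i) * KinfMinus (boundedClass B) (F i) u +
      ENNReal.ofReal (w j) * KinfPlus (boundedClass B) (F j) u)

/-- `min_{i ≠ i⋆} C_{i⋆,i}(F, w)`, the objective maximised over allocations `w`. -/
def minTransportCost (B : ℝ) (F : Fin K → ProbabilityMeasure ℝ) (istar : Fin K)
    (w : Fin K → ℝ) : ℝ≥0∞ :=
  ⨅ i ∈ {i : Fin K | i ≠ istar}, transportCost B F w istar i

/-- The allocations in the probability simplex that give weight `β` to the arm `istar`. -/
def simplexWith (istar : Fin K) (β : ℝ) : Set (Fin K → ℝ) :=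
  {w | w ∈ stdSimplex ℝ (Fin K) ∧ w istar = β}

/-- The characteristic time `T⋆(F)`, the inverse of `sup_w min_{i ≠ i⋆} C_{i⋆,i}(F, w)` over `w`
in the simplex. -/
def charTime (B : ℝ) (F : Fin K → ProbabilityMeasure ℝ) (istar : Fin K) : ℝ≥0∞ :=
  (⨆ w ∈ stdSimplex ℝ (Fin K), minTransportCost B F istar w)⁻¹

/-- The `β`-characteristic time `T⋆_β(F)`, with the supremum restricted to `w_{i⋆} = β`. -/
def charTimeWith (B : ℝ) (F : Fin K → ProbabilityMeasure ℝ) (istar : Fin K) (β : ℝ) : ℝ≥0∞ :=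
  (⨆ w ∈ simplexWith istar β, minTransportCost B F istar w)⁻¹

/-- The set `w⋆(F)` of optimal allocations (the argmax in the definition of `T⋆(F)⁻¹`). -/
def optAlloc (B : ℝ) (F : Fin K → ProbabilityMeasure ℝ) (istar : Fin K) : Set (Fin K → ℝ) :=
  {w | w ∈ stdSimplex ℝ (Fin K) ∧
    IsMaxOn (minTransportCost B F istar) (stdSimplex ℝ (Fin K)) w}

/-- The set `w⋆_β(F)` of `β`-optimal allocations (the argmax in the definition of
`T⋆_β(F)⁻¹`). -/
def optAllocWith (B : ℝ) (F : Fin K → ProbabilityMeasure ℝ) (istar : Fin K) (β : ℝ) :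
    Set (Fin K → ℝ) :=
  {w | w ∈ simplexWith istar β ∧ IsMaxOn (minTransportCost B F istar) (simplexWith istar β) w}

end

end BestArm

/-!
Fix a challenger `i`. Lowering the mean of the best arm to `u` costs `a u = KinfMinus (F istar) u`,
and raising the mean of `i` to `u` costs `b u = KinfPlus (F i) u`. The transportation cost is the
minimum of `x * a u + y * b u` over `u` between the two means, `x` and `y` being the weights of the
two arms; it is nondecreasing, concave and homogeneous in `(x, y)`, and it vanishes if either weight
does. A maximiser of the smallest cost exists by upper semicontinuity.

*Equality of the costs.* At a maximiser with value `c > 0`, no weight can be saved: nonnegative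
weights with the same weight of `istar` and all costs at least `c` have total at least `1`
(`one_le_sum_of_isMaxOn_stdSimplex`, `one_le_sum_of_isMaxOn_of_lt`). On the whole simplex this holds
because saved weight could be redistributed by scaling. If the weight of `istar` is prescribed, it
can only go to the challengers, and it is of use to them if the costs increase strictly with their
weights. They do when no challenger is a point mass: then `b` is at most quadratic just beyond the
mean of `i`, while `a` decreases at a linear rate, so the minimising `u` is not that mean
(`IsTransportPair.pairCost_lt_of_lt`). If the cost of one challenger exceeded `c`, some of its
weight could be saved, so all the costs are equal (`pairCost_eq_of_one_le_sum`).

*Uniqueness.* Two maximisers with the same weight of `istar` coincide, since their pointwise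
minimum reaches the same value (`eq_of_one_le_sum`). If the weights of `istar` differ, the midpoint
is a maximiser too, and some challenger's weights are ordered the other way. A minimising `u` for
this challenger at the midpoint minimises the weighted sum for both maximisers, and it lies strictly
between the means. As `a` and `b` have no kinks, the two first-order conditions contradict each
other (`IsTransportPair.not_pairCost_midpoint_le`).

*No kinks.* Only an upper bound of order `t ^ 2` on the second differences of the costs is needed
(`toReal_KinfSigned_second_difference_le`). A nearly optimal `G` with mean `m` and variance `V` is
replaced by the distributions with density `1 ± t (x - m) / V` relative to `G`; they have means
`m ± t`, and the first-order changes of the divergence cancel in the sum (`exists_mean_eq_add`). The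
variance `V` is bounded below since the mean of `G` differs from that of `F`
(`le_variance_of_klDiv_le`). Continuity of the costs comes from mixing `G` with a point mass at an
end of the interval, and the linear decrease of `a` from mixing `G` with `F`.
-/

namespace BestArm

/-! ### Divergences to mixtures and to tilted measures -/

section Divergence

variable {α : Type*} [MeasurableSpace α] {μ ν : Measure α} [IsProbabilityMeasure μ]
  [IsProbabilityMeasure ν]

/-- An integrable upper bound on the log-likelihood ratio bounds the divergence. No lower bound is
needed, as `log x ≤ x` already controls the negative part. -/
theorem klDiv_le_ofReal_integral_of_llr_le (hac : μ ≪ ν) {f : α → ℝ} (hf : Integrable f μ)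
    (hle : ∀ᵐ x ∂μ, llr μ ν x ≤ f x) : klDiv μ ν ≤ ENNReal.ofReal (∫ x, f x ∂μ) := by
  have hg : Integrable (fun x => (ν.rnDeriv μ x).toReal) μ := Measure.integrable_toReal_rnDeriv
  have hint : Integrable (llr μ ν) μ := by
    refine Integrable.mono' (hf.abs.add (hg.add (integrable_const 1)))
      (measurable_llr μ ν).aestronglyMeasurable ?_
    filter_upwards [hle, neg_llr hac] with x hx hx'
    have h1 : Real.log (ν.rnDeriv μ x).toReal ≤ (ν.rnDeriv μ x).toReal :=
      Real.log_le_self ENNReal.toReal_nonneg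
    have h2 : -llr μ ν x = Real.log (ν.rnDeriv μ x).toReal := hx'
    have h3 : 0 ≤ (ν.rnDeriv μ x).toReal := ENNReal.toReal_nonneg
    have h4 := le_abs_self (f x)
    have h5 := abs_nonneg (f x)
    simp only [Pi.add_apply]
    rw [Real.norm_eq_abs, abs_le]
    constructor <;> linarith
  rw [klDiv_of_ac_of_integrable hac hint]
  apply ENNReal.ofReal_le_ofReal
  have := integral_mono_ae hint hf hle
  simpa using this

/-- The density, relative to `μ`, of a mixture. -/
theorem toReal_rnDeriv_mixture {ρ : Measure α} [IsProbabilityMeasure ρ] {c d : ℝ} (hc : 0 ≤ c)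
    (hd : 0 ≤ d) :
    (fun x => ((ENNReal.ofReal c • ν + ENNReal.ofReal d • ρ).rnDeriv μ x).toReal) =ᵐ[μ]
      fun x => c * (ν.rnDeriv μ x).toReal + d * (ρ.rnDeriv μ x).toReal := by
  have : IsFiniteMeasure (ENNReal.ofReal c • ν) := Measure.smul_finite _ ENNReal.ofReal_ne_top
  have : IsFiniteMeasure (ENNReal.ofReal d • ρ) := Measure.smul_finite _ ENNReal.ofReal_ne_top
  filter_upwards [Measure.rnDeriv_add (ENNReal.ofReal c • ν) (ENNReal.ofReal d • ρ) μ,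
    Measure.rnDeriv_smul_left_of_ne_top ν μ (r := ENNReal.ofReal c) ENNReal.ofReal_ne_top,
    Measure.rnDeriv_smul_left_of_ne_top ρ μ (r := ENNReal.ofReal d) ENNReal.ofReal_ne_top,
    Measure.rnDeriv_ne_top ν μ, Measure.rnDeriv_ne_top ρ μ] with x h1 h2 h3 h4 h5
  rw [h1, Pi.add_apply, h2, h3]
  simp only [Pi.smul_apply, smul_eq_mul]
  rw [ENNReal.toReal_add (ENNReal.mul_ne_top ENNReal.ofReal_ne_top h4)
    (ENNReal.mul_ne_top ENNReal.ofReal_ne_top h5)]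
  simp [hc, hd]

theorem isProbabilityMeasure_mixture {ρ : Measure α} [IsProbabilityMeasure ρ] {t : ℝ} (ht : 0 ≤ t)
    (ht1 : t ≤ 1) :
    IsProbabilityMeasure (ENNReal.ofReal (1 - t) • ν + ENNReal.ofReal t • ρ) := by
  constructor
  simp [← ENNReal.ofReal_add (sub_nonneg.2 ht1) ht]

theorem absolutelyContinuous_mixture {μ ν : Measure α} (ρ : Measure α) {t : ℝ} (ht1 : t < 1)
    (h : μ ≪ ν) : μ ≪ ENNReal.ofReal (1 - t) • ν + ENNReal.ofReal t • ρ := by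
  have h0 : ENNReal.ofReal (1 - t) ≠ 0 := by simpa using ht1
  exact (h.trans (Measure.absolutelyContinuous_smul h0)).add_right _

/-- A component of weight `1 - t` costs at most `-log (1 - t)`. -/
theorem klDiv_mixture_le {ρ : Measure α} [IsProbabilityMeasure ρ] {t : ℝ} (ht : 0 ≤ t)
    (ht1 : t < 1) :
    klDiv μ (ENNReal.ofReal (1 - t) • ν + ENNReal.ofReal t • ρ) ≤
      klDiv μ ν + ENNReal.ofReal (-Real.log (1 - t)) := by
  by_cases hfin : klDiv μ ν = ∞
  · simp [hfin]
  obtain ⟨hac, hint⟩ := klDiv_ne_top_iff.1 hfin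
  have := isProbabilityMeasure_mixture (ν := ν) (ρ := ρ) ht ht1.le
  have hac' := absolutelyContinuous_mixture ρ ht1 hac
  have hlog : Real.log (1 - t) ≤ 0 := Real.log_nonpos (by linarith) (by linarith)
  have hle := klDiv_le_ofReal_integral_of_llr_le hac'
    (hint.add (integrable_const (-Real.log (1 - t)))) (by
      filter_upwards [neg_llr hac', neg_llr hac, Measure.rnDeriv_pos' hac,
        Measure.rnDeriv_ne_top ν μ,
        toReal_rnDeriv_mixture (μ := μ) (ν := ν) (ρ := ρ) (sub_nonneg.2 ht1.le) ht]
        with x h1 h2 h3 h4 h5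
      have h3' := ENNReal.toReal_pos h3.ne' h4
      have h6 : 0 ≤ (ρ.rnDeriv μ x).toReal := ENNReal.toReal_nonneg
      simp only [Pi.neg_apply, llr_def _ μ] at h1 h2
      rw [h5] at h1
      have h7 : Real.log ((1 - t) * (ν.rnDeriv μ x).toReal) ≤
          Real.log ((1 - t) * (ν.rnDeriv μ x).toReal + t * (ρ.rnDeriv μ x).toReal) :=
        Real.log_le_log (mul_pos (by linarith) h3') (by nlinarith)
      rw [Real.log_mul (by linarith) h3'.ne'] at h7
      simp only [Pi.add_apply]
      linarith)
  refine hle.trans ?_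
  simp only [Pi.add_apply]
  rw [integral_add hint (integrable_const _), ← toReal_klDiv_of_measure_eq hac (by simp)]
  simp only [integral_const, probReal_univ, smul_eq_mul, one_mul]
  rw [ENNReal.ofReal_add ENNReal.toReal_nonneg (by linarith), ENNReal.ofReal_toReal hfin]

/-- Convexity of the divergence in its second argument along the segment that ends at the first
argument. -/
theorem klDiv_mixture_self_le {t : ℝ} (ht : 0 ≤ t) (ht1 : t < 1) :
    klDiv μ (ENNReal.ofReal (1 - t) • ν + ENNReal.ofReal t • μ) ≤
      ENNReal.ofReal (1 - t) * klDiv μ ν := by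
  by_cases hfin : klDiv μ ν = ∞
  · rw [hfin, ENNReal.mul_top (by simpa using ht1)]
    exact le_top
  obtain ⟨hac, hint⟩ := klDiv_ne_top_iff.1 hfin
  have := isProbabilityMeasure_mixture (ν := ν) (ρ := μ) ht ht1.le
  have hac' := absolutelyContinuous_mixture μ ht1 hac
  have hle := klDiv_le_ofReal_integral_of_llr_le hac' (hint.const_mul (1 - t)) (by
      filter_upwards [neg_llr hac', neg_llr hac, Measure.rnDeriv_pos' hac,
        Measure.rnDeriv_ne_top ν μ, Measure.rnDeriv_self μ,
        toReal_rnDeriv_mixture (μ := μ) (ν := ν) (ρ := μ) (sub_nonneg.2 ht1.le) ht]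
        with x h1 h2 h3 h4 h6 h5
      have h3' := ENNReal.toReal_pos h3.ne' h4
      simp only [Pi.neg_apply, llr_def _ μ] at h1 h2
      rw [h5, h6] at h1
      have h7 := strictConcaveOn_log_Ioi.concaveOn.2 (Set.mem_Ioi.2 h3')
        (Set.mem_Ioi.2 one_pos) (sub_nonneg.2 ht1.le) ht (by ring)
      simp only [smul_eq_mul, Real.log_one, mul_zero, add_zero] at h7
      simp only [ENNReal.toReal_one] at h1
      rw [← h1, ← h2] at h7
      linarith)
  refine hle.trans ?_
  rw [integral_const_mul, ← toReal_klDiv_of_measure_eq hac (by simp),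
    ENNReal.ofReal_mul (by linarith), ENNReal.ofReal_toReal hfin]

/-- The Donsker–Varadhan lower bound, from nonnegativity of the divergence to a tilted measure. -/
theorem integral_sub_integral_exp_le_toReal_klDiv (hfin : klDiv μ ν ≠ ∞) {g : α → ℝ}
    (hg : Integrable g μ) (hexp : Integrable (fun x => Real.exp (g x)) ν) :
    ∫ x, g x ∂μ - (∫ x, Real.exp (g x) ∂ν - 1) ≤ (klDiv μ ν).toReal := by
  obtain ⟨hac, hint⟩ := klDiv_ne_top_iff.1 hfin
  have := isProbabilityMeasure_tilted hexp
  have hac' := hac.trans (absolutelyContinuous_tilted hexp)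
  have h1 := toReal_klDiv_of_measure_eq hac' (by simp)
  rw [integral_llr_tilted_right hac hg hexp hint,
    ← toReal_klDiv_of_measure_eq hac (by simp)] at h1
  have h2 : 0 ≤ (klDiv μ (ν.tilted g)).toReal := ENNReal.toReal_nonneg
  have h3 := Real.log_le_sub_one_of_pos (integral_exp_pos hexp)
  linarith

end Divergence

/-! ### Distributions on a bounded interval -/

theorem mem_boundedClass_iff {B : ℝ} {G : ProbabilityMeasure ℝ} :
    G ∈ boundedClass B ↔ ∀ᵐ x ∂(G : Measure ℝ), x ∈ Set.Icc 0 B := by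
  constructor
  · intro h
    filter_upwards [(G : Measure ℝ).support_mem_ae] with x hx using h hx
  · intro h
    exact Measure.support_subset_of_isClosed isClosed_Icc h

section Bounded

variable {B : ℝ} {F G : ProbabilityMeasure ℝ}

theorem integrable_of_mem_boundedClass (hG : G ∈ boundedClass B) {f : ℝ → ℝ} (hf : Measurable f)
    {C : ℝ} (hC : ∀ x ∈ Set.Icc 0 B, |f x| ≤ C) : Integrable f (G : Measure ℝ) := by
  refine Integrable.of_bound hf.aestronglyMeasurable C ?_
  filter_upwards [mem_boundedClass_iff.1 hG] with x hx using hC x hx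

theorem integrable_of_continuous (hG : G ∈ boundedClass B) {f : ℝ → ℝ} (hf : Continuous f) :
    Integrable f (G : Measure ℝ) := by
  obtain ⟨C, hC⟩ := isCompact_Icc.exists_bound_of_continuousOn (hf.continuousOn (s := Set.Icc 0 B))
  exact integrable_of_mem_boundedClass hG hf.measurable hC

theorem mean_mem_Icc (hG : G ∈ boundedClass B) : mean G ∈ Set.Icc 0 B := by
  have hi := integrable_of_continuous hG continuous_id
  constructor
  · exact integral_nonneg_of_ae ((mem_boundedClass_iff.1 hG).mono fun x hx => hx.1)
  · have := integral_mono_ae hi (integrable_const B)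
      ((mem_boundedClass_iff.1 hG).mono fun x hx => hx.2)
    simpa [mean] using this

/-- The variance of a distribution. -/
noncomputable def variance (G : ProbabilityMeasure ℝ) : ℝ :=
  ∫ x, (x - mean G) ^ 2 ∂(G : Measure ℝ)

theorem integral_sub_mean (hG : G ∈ boundedClass B) (c : ℝ) :
    ∫ x, (x - c) ∂(G : Measure ℝ) = mean G - c := by
  rw [integral_sub (f := fun x => x) (integrable_of_continuous hG continuous_id)
    (integrable_const _)]
  simp [mean]

theorem variance_le (hG : G ∈ boundedClass B) : variance G ≤ B ^ 2 := by
  have h := integral_mono_ae (μ := (G : Measure ℝ)) (f := fun x => (x - mean G) ^ 2)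
    (g := fun _ => B ^ 2) (integrable_of_continuous hG (by fun_prop)) (integrable_const _) (by
      filter_upwards [mem_boundedClass_iff.1 hG] with x hx
      have := mean_mem_Icc hG
      have h1 := hx.1; have h2 := hx.2; have h3 := this.1; have h4 := this.2
      have : |x - mean G| ≤ B := by rw [abs_le]; constructor <;> linarith
      exact sq_le_sq' (abs_le.1 this).1 (abs_le.1 this).2)
  simpa [variance] using h

theorem variance_pos (hG : G ∈ boundedClass B)
    (hne : ∀ x : ℝ, (G : Measure ℝ) ≠ Measure.dirac x) : 0 < variance G := by
  have h0 : 0 ≤ variance G := integral_nonneg fun x => sq_nonneg _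
  refine lt_of_le_of_ne h0 fun h => hne (mean G) ?_
  have h1 := (integral_eq_zero_iff_of_nonneg (μ := (G : Measure ℝ))
    (f := fun x : ℝ => (x - mean G) ^ 2) (fun x => sq_nonneg _)
    (integrable_of_continuous hG (by fun_prop))).1 h.symm
  have h2 : (id : ℝ → ℝ) =ᵐ[(G : Measure ℝ)] fun _ => mean G := by
    filter_upwards [h1] with x hx
    have : (x - mean G) ^ 2 = 0 := hx
    have := pow_eq_zero_iff (two_ne_zero) |>.1 this
    simp only [id]; linarith
  have h3 := Measure.map_congr (mβ := inferInstance) h2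
  rw [Measure.map_id, Measure.map_const, measure_univ, one_smul] at h3
  exact h3

/-- A quantitative Gibbs inequality: the divergence separates distributions with different
means. -/
theorem sq_mean_sub_le_klDiv (hB : 0 < B) (hF : F ∈ boundedClass B) (hG : G ∈ boundedClass B) :
    ENNReal.ofReal ((mean G - mean F) ^ 2 / (4 * B ^ 2)) ≤
      klDiv (F : Measure ℝ) (G : Measure ℝ) := by
  by_cases hfin : klDiv (F : Measure ℝ) (G : Measure ℝ) = ∞
  · simp [hfin]
  rw [← ENNReal.ofReal_toReal hfin]
  apply ENNReal.ofReal_le_ofReal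
  have hmG := mean_mem_Icc hG
  have hmF := mean_mem_Icc hF
  -- The slope `s` maximises the quadratic `s * δ - s ^ 2 * B ^ 2` obtained below.
  set δ := mean F - mean G with hδ
  set s := δ / (2 * B ^ 2) with hs
  have hsB : |s| * B ≤ 1 := by
    have : |δ| ≤ B := by
      rw [abs_le]; constructor <;> linarith [hmG.1, hmG.2, hmF.1, hmF.2]
    rw [hs, abs_div, abs_of_pos (by positivity : 0 < 2 * B ^ 2), div_mul_eq_mul_div,
      div_le_one (by positivity)]
    nlinarith
  have h1 := integral_sub_integral_exp_le_toReal_klDiv hfin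
    (g := fun x => s * (x - mean G)) (integrable_of_continuous hF (by fun_prop))
    (integrable_of_continuous hG (by fun_prop))
  have h2 : ∫ x, Real.exp (s * (x - mean G)) ∂(G : Measure ℝ) ≤
      ∫ x, (1 + s * (x - mean G) + s ^ 2 * (x - mean G) ^ 2) ∂(G : Measure ℝ) := by
    refine integral_mono_ae (integrable_of_continuous hG (by fun_prop))
      (integrable_of_continuous hG (by fun_prop)) ?_
    filter_upwards [mem_boundedClass_iff.1 hG] with x hx
    have hx' : |x - mean G| ≤ B := by
      rw [abs_le]; constructor <;> linarith [hx.1, hx.2, hmG.1, hmG.2]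
    have habs : |s * (x - mean G)| ≤ 1 := by
      rw [abs_mul]
      exact (mul_le_mul_of_nonneg_left hx' (abs_nonneg _)).trans hsB
    have := abs_le.1 (Real.abs_exp_sub_one_sub_id_le habs)
    show Real.exp (s * (x - mean G)) ≤ _
    nlinarith [this.2]
  rw [integral_add (integrable_of_continuous hG (by fun_prop))
    (integrable_of_continuous hG (by fun_prop)), integral_add (integrable_const _)
    (integrable_of_continuous hG (by fun_prop)), integral_const_mul, integral_const_mul,
    integral_sub_mean hG] at h2
  rw [integral_const_mul, integral_sub_mean hF] at h1
  simp only [integral_const, probReal_univ, smul_eq_mul, mul_one, sub_self, mul_zero,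
    add_zero] at h2
  have h3 := mul_le_mul_of_nonneg_left (variance_le hG) (sq_nonneg s)
  have h4 : (mean G - mean F) ^ 2 / (4 * B ^ 2) = s * δ - s ^ 2 * B ^ 2 := by
    rw [hs, hδ]; field_simp; ring
  rw [h4]
  unfold variance at h3
  linarith

/-- A distribution at bounded divergence from `F` and with another mean than `F` cannot be too
concentrated. -/
theorem le_variance_of_klDiv_le (hF : F ∈ boundedClass B) (hG : G ∈ boundedClass B)
    (hfin : klDiv (F : Measure ℝ) (G : Measure ℝ) ≠ ∞) {M δ : ℝ}
    (hM : (klDiv (F : Measure ℝ) (G : Measure ℝ)).toReal ≤ M) (hδ : 0 < δ)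
    (hmean : δ ≤ |mean G - mean F|) :
    Real.exp (-((M + 1) / δ ^ 2 * B ^ 2)) / ((M + 1) / δ ^ 2) ≤ variance G := by
  have hM0 : 0 ≤ M := ENNReal.toReal_nonneg.trans hM
  set a := (M + 1) / δ ^ 2 with ha
  have ha0 : 0 < a := by positivity
  have hmG := mean_mem_Icc hG
  have h1 := integral_sub_integral_exp_le_toReal_klDiv hfin
    (g := fun x => a * (x - mean G) ^ 2) (integrable_of_continuous hF (by fun_prop))
    (integrable_of_continuous hG (by fun_prop))
  have h2 : ∫ x, Real.exp (a * (x - mean G) ^ 2) ∂(G : Measure ℝ) ≤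
      ∫ x, (1 + a * Real.exp (a * B ^ 2) * (x - mean G) ^ 2) ∂(G : Measure ℝ) := by
    refine integral_mono_ae (integrable_of_continuous hG (by fun_prop))
      (integrable_of_continuous hG (by fun_prop)) ?_
    filter_upwards [mem_boundedClass_iff.1 hG] with x hx
    have hx' : (x - mean G) ^ 2 ≤ B ^ 2 :=
      sq_le_sq' (by linarith [hx.1, hmG.2]) (by linarith [hx.2, hmG.1])
    show Real.exp (a * (x - mean G) ^ 2) ≤ _
    set z := a * (x - mean G) ^ 2 with hz
    have hz0 : 0 ≤ z := by positivity
    have hzB : Real.exp z ≤ Real.exp (a * B ^ 2) :=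
      Real.exp_le_exp.2 (mul_le_mul_of_nonneg_left hx' ha0.le)
    -- `exp z - 1 ≤ z * exp z`
    have h3 : (1 - z) * Real.exp z ≤ 1 := by
      have := Real.add_one_le_exp (-z)
      calc (1 - z) * Real.exp z ≤ Real.exp (-z) * Real.exp z := by
            gcongr; linarith
        _ = 1 := by rw [← Real.exp_add]; simp
    have h4 := mul_le_mul_of_nonneg_left hzB hz0
    have h5 : a * Real.exp (a * B ^ 2) * (x - mean G) ^ 2 = z * Real.exp (a * B ^ 2) := by
      rw [hz]; ring
    rw [h5]; linarith
  rw [integral_add (integrable_const _) (integrable_of_continuous hG (by fun_prop)),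
    integral_const_mul] at h2
  simp only [integral_const, probReal_univ, smul_eq_mul, mul_one] at h2
  have h3 : δ ^ 2 ≤ ∫ x, (x - mean G) ^ 2 ∂(F : Measure ℝ) := by
    -- Jensen: the second moment about `mean G` dominates the square of the first.
    have h4 : ∫ x, (2 * (mean F - mean G) * (x - mean G) - (mean F - mean G) ^ 2) ∂(F : Measure ℝ) ≤
        ∫ x, (x - mean G) ^ 2 ∂(F : Measure ℝ) := by
      refine integral_mono (integrable_of_continuous hF (by fun_prop))
        (integrable_of_continuous hF (by fun_prop)) fun x => ?_
      show 2 * (mean F - mean G) * (x - mean G) - (mean F - mean G) ^ 2 ≤ (x - mean G) ^ 2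
      nlinarith [sq_nonneg (x - mean F)]
    rw [integral_sub (integrable_of_continuous hF (by fun_prop)) (integrable_const _),
      integral_const_mul, integral_sub_mean hF] at h4
    simp only [integral_const, probReal_univ, smul_eq_mul, one_mul] at h4
    have h5 : δ ^ 2 ≤ |mean G - mean F| ^ 2 := pow_le_pow_left₀ hδ.le hmean 2
    rw [sq_abs] at h5
    nlinarith
  rw [integral_const_mul] at h1
  have h5 : a * δ ^ 2 = M + 1 := by rw [ha]; field_simp
  have h6 := mul_le_mul_of_nonneg_left h3 ha0.le
  have h7 : 1 ≤ a * Real.exp (a * B ^ 2) * variance G := by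
    unfold variance; linarith
  rw [Real.exp_neg, div_le_iff₀ ha0, inv_le_iff_one_le_mul₀ (Real.exp_pos _)]
  linarith

/-- Moving the mean of `G` by `t` through the density `1 + t (x - m) / V`, with `m` the mean and
`V` the variance of `G`. As `t` may have either sign, the divergence is bounded to second order by
an affine function of `t`. -/
theorem exists_mean_eq_add (hF : F ∈ boundedClass B) (hG : G ∈ boundedClass B)
    (hfin : klDiv (F : Measure ℝ) (G : Measure ℝ) ≠ ∞) (hV : 0 < variance G) {t : ℝ}
    (ht : |t| * B / variance G ≤ 1 / 2) :
    ∃ G' ∈ boundedClass B, mean G' = mean G + t ∧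
      klDiv (F : Measure ℝ) (G' : Measure ℝ) ≠ ∞ ∧
      (klDiv (F : Measure ℝ) (G' : Measure ℝ)).toReal ≤
        (klDiv (F : Measure ℝ) (G : Measure ℝ)).toReal +
          (mean G - mean F) / variance G * t + 2 * (t * B / variance G) ^ 2 := by
  obtain ⟨hac, hint⟩ := klDiv_ne_top_iff.1 hfin
  have hmG := mean_mem_Icc hG
  set V := variance G with hVdef
  set h : ℝ → ℝ := fun x => t * (x - mean G) / V with hh
  have hhc : Continuous h := by fun_prop
  have hbound : ∀ x ∈ Set.Icc 0 B, |h x| ≤ |t| * B / V := by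
    intro x hx
    have hx' : |x - mean G| ≤ B := by
      rw [abs_le]; constructor <;> linarith [hx.1, hx.2, hmG.1, hmG.2]
    rw [hh]
    simp only
    rw [abs_div, abs_mul, abs_of_pos hV]
    gcongr
  set f : ℝ → ℝ := fun x => Real.log (1 + h x) with hf
  have hfm : Measurable f := by fun_prop
  have hfb : ∀ x ∈ Set.Icc 0 B, h x - 2 * (t * B / V) ^ 2 ≤ f x ∧ Real.exp (f x) = 1 + h x := by
    intro x hx
    have hx1 : |h x| ≤ 1 / 2 := (hbound x hx).trans ht
    have h1 := abs_le.1 hx1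
    refine ⟨?_, Real.exp_log (by linarith)⟩
    have h2 := Real.abs_log_sub_add_sum_range_le (x := -h x) (by rw [abs_neg]; linarith) 1
    simp only [Finset.range_one, Finset.sum_singleton, abs_neg, sub_neg_eq_add] at h2
    norm_num at h2
    have h4 : h x ^ 2 / (1 - |h x|) ≤ 2 * h x ^ 2 := by
      rw [div_le_iff₀ (by linarith)]
      nlinarith [sq_nonneg (h x)]
    have h5 : h x ^ 2 ≤ (t * B / V) ^ 2 := by
      refine sq_le_sq.2 ((hbound x hx).trans ?_)
      rw [abs_div, abs_mul, abs_of_pos hV]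
      gcongr
      exact le_abs_self B
    have h3 := (abs_le.1 h2).1
    show _ ≤ Real.log (1 + h x)
    linarith
  have hexp_ae : (fun x => Real.exp (f x)) =ᵐ[(G : Measure ℝ)] fun x => 1 + h x :=
    (mem_boundedClass_iff.1 hG).mono fun x hx => (hfb x hx).2
  have hexp_int : Integrable (fun x => Real.exp (f x)) (G : Measure ℝ) :=
    (integrable_congr hexp_ae).2 (integrable_of_continuous hG (by fun_prop))
  have hh_int (H : ProbabilityMeasure ℝ)
      (hH : H ∈ boundedClass B) : ∫ x, h x ∂(H : Measure ℝ) = t * (mean H - mean G) / V := by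
    simp only [hh]
    rw [integral_div, integral_const_mul, integral_sub_mean hH]
  have hexp_one : ∫ x, Real.exp (f x) ∂(G : Measure ℝ) = 1 := by
    rw [integral_congr_ae hexp_ae, integral_add (integrable_const _)
      (integrable_of_continuous hG hhc), hh_int G hG]
    simp
  have hprob := isProbabilityMeasure_tilted hexp_int
  have hf_int : Integrable f (F : Measure ℝ) := by
    have hcont : Continuous fun x => |h x| + 2 * (t * B / V) ^ 2 := by fun_prop
    refine Integrable.mono' (integrable_of_continuous hF hcont) hfm.aestronglyMeasurable ?_
    filter_upwards [mem_boundedClass_iff.1 hF] with x hx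
    have h1 := hfb x hx
    have h2 := Real.add_one_le_exp (f x)
    rw [Real.norm_eq_abs, abs_le]
    constructor <;> linarith [le_abs_self (h x), neg_abs_le (h x), sq_nonneg (t * B / V)]
  refine ⟨⟨(G : Measure ℝ).tilted f, hprob⟩, ?_, ?_, ?_, ?_⟩
  · exact mem_boundedClass_iff.2 ((tilted_absolutelyContinuous (G : Measure ℝ) f).ae_le
      (mem_boundedClass_iff.1 hG))
  · have h1 : ∀ x, (1 + h x) * x = x + t / V * ((x - mean G) ^ 2 + mean G * (x - mean G)) := by
      intro x; simp only [hh]; field_simp; ring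
    show ∫ x, x ∂((G : Measure ℝ).tilted f) = _
    rw [integral_tilted]
    simp only [hexp_one, div_one, smul_eq_mul]
    rw [integral_congr_ae (hexp_ae.mono fun x hx => by
      show Real.exp (f x) * x = x + t / V * ((x - mean G) ^ 2 + mean G * (x - mean G))
      rw [← h1 x]
      exact congrArg (· * x) hx),
      integral_add (integrable_of_continuous hG (by fun_prop))
        (integrable_of_continuous hG (by fun_prop)), integral_const_mul,
      integral_add (integrable_of_continuous hG (by fun_prop))
        (integrable_of_continuous hG (by fun_prop)), integral_const_mul, integral_sub_mean hG]
    show mean G + t / V * (V + _) = _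
    field_simp
    ring
  · exact klDiv_ne_top (hac.trans (absolutelyContinuous_tilted hexp_int))
      (integrable_llr_tilted_right hac hf_int hint hexp_int)
  · show (klDiv (F : Measure ℝ) ((G : Measure ℝ).tilted f)).toReal ≤ _
    have hac' := hac.trans (absolutelyContinuous_tilted hexp_int)
    rw [toReal_klDiv_of_measure_eq hac' (by simp),
      integral_llr_tilted_right hac hf_int hexp_int hint, hexp_one,
      ← toReal_klDiv_of_measure_eq hac (by simp)]
    have h2 := integral_mono_ae (μ := (F : Measure ℝ)) (f := fun x => h x - 2 * (t * B / V) ^ 2)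
      (integrable_of_continuous hF (by fun_prop)) hf_int
      ((mem_boundedClass_iff.1 hF).mono fun x hx => (hfb x hx).1)
    rw [integral_sub (integrable_of_continuous hF hhc) (integrable_const _),
      hh_int F hF] at h2
    simp only [integral_const, probReal_univ, smul_eq_mul, one_mul] at h2
    have h3 : (mean G - mean F) / V * t = -(t * (mean F - mean G) / V) := by ring
    rw [h3]
    simp only [Real.log_one]
    linarith

/-- The mixture `(1 - t) G + t H` of two distributions. -/
noncomputable def mixture (t : ℝ) (ht : 0 ≤ t) (ht1 : t ≤ 1) (G H : ProbabilityMeasure ℝ) :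
    ProbabilityMeasure ℝ :=
  ⟨ENNReal.ofReal (1 - t) • (G : Measure ℝ) + ENNReal.ofReal t • (H : Measure ℝ),
    isProbabilityMeasure_mixture ht ht1⟩

theorem mixture_mem_boundedClass {H : ProbabilityMeasure ℝ} (hG : G ∈ boundedClass B)
    (hH : H ∈ boundedClass B) {t : ℝ} (ht : 0 ≤ t) (ht1 : t ≤ 1) :
    mixture t ht ht1 G H ∈ boundedClass B := by
  rw [mem_boundedClass_iff] at *
  exact ae_add_measure_iff.2 ⟨Measure.ae_smul_measure hG _, Measure.ae_smul_measure hH _⟩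

theorem mean_mixture {H : ProbabilityMeasure ℝ} (hG : G ∈ boundedClass B)
    (hH : H ∈ boundedClass B) {t : ℝ} (ht : 0 ≤ t) (ht1 : t ≤ 1) :
    mean (mixture t ht ht1 G H) = (1 - t) * mean G + t * mean H := by
  show ∫ x, x ∂(ENNReal.ofReal (1 - t) • (G : Measure ℝ) + ENNReal.ofReal t • (H : Measure ℝ)) = _
  rw [integral_add_measure (f := fun x : ℝ => x)
    ((integrable_of_continuous hG continuous_id).smul_measure ENNReal.ofReal_ne_top)
    ((integrable_of_continuous hH continuous_id).smul_measure ENNReal.ofReal_ne_top),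
    integral_smul_measure, integral_smul_measure, ENNReal.toReal_ofReal (by linarith),
    ENNReal.toReal_ofReal ht]
  rfl

end Bounded

/-! ### Divergence costs as functions of the level -/

/-- The qualitative properties of a real cost `k` on the half-line below `E`, vanishing exactly up
to `M`, on which the optimisation over allocations relies: monotonicity, a modulus of continuity,
the chord inequality towards `M`, and an upper bound on second differences. The last one says that
`k`, were it convex, would have no kink in the interior. The continuity bound `sub_le` expresses
that `k u + log (E - u)` is antitone. -/
structure IsCostProfile (k : ℝ → ℝ) (M E : ℝ) : Prop where
  lt : M < E
  nonneg : ∀ u, 0 ≤ k u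
  mono : ∀ {u v}, u ≤ v → v < E → k u ≤ k v
  eq_zero : ∀ {u}, u ≤ M → k u = 0
  pos : ∀ {u}, M < u → u < E → 0 < k u
  sub_le : ∀ {u v}, u ≤ v → v < E → k v - k u ≤ Real.log (E - u) - Real.log (E - v)
  chord_le : ∀ {u θ}, u < E → 0 ≤ θ → θ < 1 → k ((1 - θ) * u + θ * M) ≤ (1 - θ) * k u
  second_difference_le : ∀ {u}, M < u → u < E →
    ∃ C, ∃ t₀ > 0, ∀ t, 0 < t → t ≤ t₀ → k (u + t) + k (u - t) ≤ 2 * k u + C * t ^ 2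

theorem IsCostProfile.continuousOn {k : ℝ → ℝ} {M E : ℝ} (h : IsCostProfile k M E) :
    ContinuousOn k (Set.Iio E) := by
  have key : ∀ {u v}, u < E → v < E → |k v - k u| ≤ |Real.log (E - v) - Real.log (E - u)| := by
    intro u v hu hv
    rcases le_total u v with huv | huv
    · rw [abs_of_nonneg (by linarith [h.mono huv hv]), abs_sub_comm]
      exact (h.sub_le huv hv).trans (le_abs_self _)
    · rw [abs_sub_comm, abs_of_nonneg (by linarith [h.mono huv hu])]
      exact (h.sub_le huv hu).trans (le_abs_self _)
  intro u hu
  have hlog : ContinuousWithinAt (fun v => Real.log (E - v)) (Set.Iio E) u := by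
    apply ContinuousAt.continuousWithinAt
    have : E - u ≠ 0 := (sub_pos.2 hu).ne'
    fun_prop (disch := assumption)
  rw [Metric.continuousWithinAt_iff] at hlog ⊢
  intro ε hε
  obtain ⟨δ, hδ, hd⟩ := hlog ε hε
  exact ⟨δ, hδ, fun v hv hvu => (key hu hv).trans_lt (hd hv hvu)⟩

/-- `KinfPlus` for `σ = 1` and, after reflecting `u`, `KinfMinus` for `σ = -1`. -/
noncomputable def KinfSigned (B σ : ℝ) (F : ProbabilityMeasure ℝ) (u : ℝ) : ℝ≥0∞ :=
  ⨅ G ∈ {G | G ∈ boundedClass B ∧ u < σ * mean G}, klDiv (F : Measure ℝ) (G : Measure ℝ)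

theorem KinfPlus_eq_KinfSigned (B : ℝ) (F : ProbabilityMeasure ℝ) (u : ℝ) :
    KinfPlus (boundedClass B) F u = KinfSigned B 1 F u := by
  simp [KinfPlus, KinfSigned]

theorem KinfMinus_eq_KinfSigned (B : ℝ) (F : ProbabilityMeasure ℝ) (u : ℝ) :
    KinfMinus (boundedClass B) F u = KinfSigned B (-1) F (-u) := by
  simp [KinfMinus, KinfSigned]

section Signed

variable {B σ e : ℝ} {F G : ProbabilityMeasure ℝ}

theorem KinfSigned_le (hG : G ∈ boundedClass B) {u : ℝ} (h : u < σ * mean G) :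
    KinfSigned B σ F u ≤ klDiv (F : Measure ℝ) (G : Measure ℝ) :=
  iInf₂_le G ⟨hG, h⟩

theorem KinfSigned_mono {u v : ℝ} (huv : u ≤ v) : KinfSigned B σ F u ≤ KinfSigned B σ F v :=
  le_iInf₂ fun _ hG => KinfSigned_le hG.1 (huv.trans_lt hG.2)

theorem KinfSigned_eq_zero_of_lt (hF : F ∈ boundedClass B) {u : ℝ} (h : u < σ * mean F) :
    KinfSigned B σ F u = 0 := by
  have := KinfSigned_le (F := F) hF h
  simpa using this

/-- The point mass at a point of the interval. -/
theorem dirac_mem_boundedClass (he : e ∈ Set.Icc 0 B) :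
    (⟨Measure.dirac e, inferInstance⟩ : ProbabilityMeasure ℝ) ∈ boundedClass B := by
  refine mem_boundedClass_iff.2 ?_
  exact (ae_dirac_iff measurableSet_Icc).2 he

/-- Mixing with the point mass at the extreme point `e` raises the constraint level from `u`
to `v`. -/
theorem KinfSigned_le_add (he : e ∈ Set.Icc 0 B) {u v : ℝ} (huv : u ≤ v) (hv : v < σ * e) :
    KinfSigned B σ F v ≤ KinfSigned B σ F u +
      ENNReal.ofReal (Real.log (σ * e - u) - Real.log (σ * e - v)) := by
  rw [← tsub_le_iff_right]
  refine le_iInf₂ fun G hG => tsub_le_iff_right.2 ?_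
  have hEu : 0 < σ * e - u := by linarith
  set t := (v - u) / (σ * e - u) with ht
  have ht0 : 0 ≤ t := div_nonneg (by linarith) hEu.le
  have ht1 : t < 1 := by rw [ht, div_lt_one hEu]; linarith
  have h1t : 1 - t = (σ * e - v) / (σ * e - u) := by rw [ht]; field_simp; ring
  have hmix := klDiv_mixture_le (μ := (F : Measure ℝ)) (ν := (G : Measure ℝ))
    (ρ := Measure.dirac e) ht0 ht1
  have hlog : -Real.log (1 - t) = Real.log (σ * e - u) - Real.log (σ * e - v) := by
    rw [h1t, Real.log_div (by linarith) hEu.ne']; ring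
  rw [hlog] at hmix
  set D : ProbabilityMeasure ℝ := ⟨Measure.dirac e, inferInstance⟩ with hD
  have hDm : mean D = e := by simp [mean, hD]
  refine le_trans (KinfSigned_le (G := mixture t ht0 ht1.le G D)
    (mixture_mem_boundedClass hG.1 (dirac_mem_boundedClass he) ht0 ht1.le) ?_) hmix
  rw [mean_mixture hG.1 (dirac_mem_boundedClass he) ht0 ht1.le, hDm]
  have h2 : (1 - t) * u < (1 - t) * (σ * mean G) := mul_lt_mul_of_pos_left hG.2 (by linarith)
  have h3 : (1 - t) * u + t * (σ * e) = v := by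
    rw [ht]; field_simp; ring
  linarith

theorem KinfSigned_ne_top (he : e ∈ Set.Icc 0 B) (hF : F ∈ boundedClass B) {u : ℝ}
    (hu : u < σ * e) : KinfSigned B σ F u ≠ ∞ := by
  have h := KinfSigned_le_add (F := F) he (min_le_left u (σ * mean F - 1)) hu
  rw [KinfSigned_eq_zero_of_lt hF ((min_le_right _ _).trans_lt (by linarith)), zero_add] at h
  exact ne_top_of_le_ne_top ENNReal.ofReal_ne_top h

theorem toReal_KinfSigned_sub_le (he : e ∈ Set.Icc 0 B) (hF : F ∈ boundedClass B) {u v : ℝ}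
    (huv : u ≤ v) (hv : v < σ * e) :
    (KinfSigned B σ F v).toReal - (KinfSigned B σ F u).toReal ≤
      Real.log (σ * e - u) - Real.log (σ * e - v) := by
  have h := KinfSigned_le_add (F := F) he huv hv
  have hu := KinfSigned_ne_top he hF (huv.trans_lt hv)
  have hlog : Real.log (σ * e - v) ≤ Real.log (σ * e - u) :=
    Real.log_le_log (by linarith) (by linarith)
  have h2 := ENNReal.toReal_mono (ENNReal.add_ne_top.2 ⟨hu, ENNReal.ofReal_ne_top⟩) h
  rw [ENNReal.toReal_add hu ENNReal.ofReal_ne_top, ENNReal.toReal_ofReal (by linarith)] at h2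
  linarith

theorem toReal_KinfSigned_eq_zero (he : e ∈ Set.Icc 0 B) (hF : F ∈ boundedClass B)
    (hlt : σ * mean F < σ * e) {u : ℝ} (hu : u ≤ σ * mean F) :
    (KinfSigned B σ F u).toReal = 0 := by
  rcases hu.lt_or_eq with h | rfl
  · simp [KinfSigned_eq_zero_of_lt hF h]
  -- At the mean itself, let the constraint level tend to the mean from below.
  refine le_antisymm ?_ ENNReal.toReal_nonneg
  have hcont : ContinuousAt (fun u => Real.log (σ * e - u) - Real.log (σ * e - σ * mean F))
      (σ * mean F) := by
    have : σ * e - σ * mean F ≠ 0 := by linarith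
    fun_prop (disch := assumption)
  have htend := hcont.tendsto.mono_left (nhdsWithin_le_nhds (s := Set.Iio (σ * mean F)))
  rw [sub_self] at htend
  refine ge_of_tendsto htend ?_
  filter_upwards [self_mem_nhdsWithin] with u hu
  have := toReal_KinfSigned_sub_le he hF (le_of_lt hu) hlt
  rw [KinfSigned_eq_zero_of_lt hF hu] at this
  simpa using this

theorem toReal_KinfSigned_pos (hB : 0 < B) (hσ : σ ^ 2 = 1) (he : e ∈ Set.Icc 0 B)
    (hF : F ∈ boundedClass B) {u : ℝ} (hu : σ * mean F < u) (hue : u < σ * e) :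
    0 < (KinfSigned B σ F u).toReal := by
  have hpos : 0 < (u - σ * mean F) ^ 2 / (4 * B ^ 2) := by
    have := sub_pos.2 hu
    positivity
  refine ENNReal.toReal_pos (ne_of_gt (lt_of_lt_of_le (ENNReal.ofReal_pos.2 hpos) ?_))
    (KinfSigned_ne_top he hF hue)
  refine le_iInf₂ fun G hG => le_trans (ENNReal.ofReal_le_ofReal ?_)
    (sq_mean_sub_le_klDiv hB hF hG.1)
  have h1 : (mean G - mean F) ^ 2 = (σ * mean G - σ * mean F) ^ 2 := by
    rw [← mul_sub, mul_pow, hσ, one_mul]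
  rw [h1]
  have h2 := hG.2
  gcongr

theorem toReal_KinfSigned_chord_le (he : e ∈ Set.Icc 0 B) (hF : F ∈ boundedClass B) {u θ : ℝ}
    (hu : u < σ * e) (hθ : 0 ≤ θ) (hθ1 : θ < 1) :
    (KinfSigned B σ F ((1 - θ) * u + θ * (σ * mean F))).toReal ≤
      (1 - θ) * (KinfSigned B σ F u).toReal := by
  have hc0 : ENNReal.ofReal (1 - θ) ≠ 0 := by simpa using hθ1
  have key : KinfSigned B σ F ((1 - θ) * u + θ * (σ * mean F)) ≤
      ENNReal.ofReal (1 - θ) * KinfSigned B σ F u := by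
    rw [mul_comm (ENNReal.ofReal _), ← ENNReal.div_le_iff hc0 ENNReal.ofReal_ne_top]
    refine le_iInf₂ fun G hG => ?_
    rw [ENNReal.div_le_iff hc0 ENNReal.ofReal_ne_top, mul_comm (klDiv _ _)]
    refine le_trans (KinfSigned_le (G := mixture θ hθ hθ1.le G F)
      (mixture_mem_boundedClass hG.1 hF hθ hθ1.le) ?_) (klDiv_mixture_self_le hθ hθ1)
    rw [mean_mixture hG.1 hF hθ hθ1.le]
    have h2 : (1 - θ) * u < (1 - θ) * (σ * mean G) := mul_lt_mul_of_pos_left hG.2 (by linarith)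
    linarith
  have h2 := ENNReal.toReal_mono
    (ENNReal.mul_ne_top ENNReal.ofReal_ne_top (KinfSigned_ne_top he hF hu)) key
  rwa [ENNReal.toReal_mul, ENNReal.toReal_ofReal (by linarith)] at h2

/-- A nearly optimal `G` for the level `u` can be moved to the levels `u + t` and `u - t`, and the
first-order terms cancel. -/
theorem toReal_KinfSigned_second_difference_le (hB : 0 < B) (hσ : σ ^ 2 = 1)
    (he : e ∈ Set.Icc 0 B) (hF : F ∈ boundedClass B) {u : ℝ} (hu : σ * mean F < u)
    (hue : u < σ * e) :
    ∃ C, ∃ t₀ > 0, ∀ t, 0 < t → t ≤ t₀ →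
      (KinfSigned B σ F (u + t)).toReal + (KinfSigned B σ F (u - t)).toReal ≤
        2 * (KinfSigned B σ F u).toReal + C * t ^ 2 := by
  have hfin := KinfSigned_ne_top he hF hue
  set κ := (KinfSigned B σ F u).toReal with hκ
  have hκ0 : 0 ≤ κ := ENNReal.toReal_nonneg
  have hδ := sub_pos.2 hu
  set δ := u - σ * mean F with hδdef
  set v₀ := Real.exp (-((κ + 1 + 1) / δ ^ 2 * B ^ 2)) / ((κ + 1 + 1) / δ ^ 2) with hv₀
  have hv₀pos : 0 < v₀ := by positivity
  have habsσ : |σ| = 1 :=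
    (pow_eq_one_iff_of_nonneg (abs_nonneg σ) two_ne_zero).1 (by rwa [sq_abs])
  refine ⟨4 * (B / v₀) ^ 2, v₀ / (2 * B), by positivity, fun t ht htt => ?_⟩
  refine le_of_forall_pos_le_add fun ε' hε' => ?_
  obtain ⟨ε, hε, hεε', hε1⟩ : ∃ ε > 0, 2 * ε ≤ ε' ∧ ε ≤ 1 :=
    ⟨min (ε' / 2) 1, by positivity, by linarith [min_le_left (ε' / 2) 1], min_le_right _ _⟩
  have hlt : KinfSigned B σ F u < ENNReal.ofReal (κ + ε) := by
    rw [ENNReal.lt_ofReal_iff_toReal_lt hfin]; linarith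
  obtain ⟨G, hG⟩ := iInf_lt_iff.1 hlt
  obtain ⟨⟨hGm, hGu⟩, hGlt⟩ := iInf_lt_iff.1 hG
  have hGfin := hGlt.ne_top
  have hGle : (klDiv (F : Measure ℝ) (G : Measure ℝ)).toReal ≤ κ + ε :=
    ENNReal.toReal_le_of_le_ofReal (by linarith) hGlt.le
  have hV : v₀ ≤ variance G := by
    refine le_variance_of_klDiv_le hF hGm hGfin (hGle.trans (by linarith)) hδ ?_
    have h1 : |mean G - mean F| = |σ * mean G - σ * mean F| := by
      rw [← mul_sub, abs_mul, habsσ, one_mul]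
    rw [h1]
    exact le_trans (by linarith) (le_abs_self _)
  have hVpos := hv₀pos.trans_le hV
  have hstep : t * B / variance G ≤ t * B / v₀ := by gcongr
  have hsmall : t * B / variance G ≤ 1 / 2 := by
    refine hstep.trans ?_
    rw [div_le_iff₀ hv₀pos]
    rw [le_div_iff₀ (by positivity)] at htt
    linarith
  have hsq : (t * B / variance G) ^ 2 ≤ (B / v₀) ^ 2 * t ^ 2 := by
    calc (t * B / variance G) ^ 2 ≤ (t * B / v₀) ^ 2 := by gcongr
      _ = (B / v₀) ^ 2 * t ^ 2 := by ring
  obtain ⟨G₁, hG₁, hm₁, hf₁, hk₁⟩ := exists_mean_eq_add hF hGm hGfin hVpos (t := σ * t)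
    (by rwa [abs_mul, habsσ, one_mul, abs_of_pos ht])
  obtain ⟨G₂, hG₂, hm₂, hf₂, hk₂⟩ := exists_mean_eq_add hF hGm hGfin hVpos (t := -(σ * t))
    (by rwa [abs_neg, abs_mul, habsσ, one_mul, abs_of_pos ht])
  have hσσ : σ * σ = 1 := by rw [← sq, hσ]
  have hσt : (σ * t * B / variance G) ^ 2 = (t * B / variance G) ^ 2 := by
    rw [mul_assoc σ, mul_div_assoc, mul_pow, hσ, one_mul]
  have hσt' : (-(σ * t) * B / variance G) ^ 2 = (t * B / variance G) ^ 2 := by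
    rw [← hσt]; ring
  rw [hσt] at hk₁
  rw [hσt'] at hk₂
  have h₁ := ENNReal.toReal_mono hf₁ (KinfSigned_le (F := F) (σ := σ) (u := u + t) hG₁ (by
    rw [hm₁, mul_add, ← mul_assoc, hσσ]; linarith))
  have h₂ := ENNReal.toReal_mono hf₂ (KinfSigned_le (F := F) (σ := σ) (u := u - t) hG₂ (by
    rw [hm₂, mul_add, mul_neg, ← mul_assoc, hσσ]; linarith))
  linarith

/-- For a distribution that is not a point mass, the cost grows at most quadratically just beyond
the mean. -/
theorem toReal_KinfSigned_mean_add_le (hσ : σ ^ 2 = 1) (hF : F ∈ boundedClass B)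
    (hne : ∀ x : ℝ, (F : Measure ℝ) ≠ Measure.dirac x) (hB : 0 < B) :
    ∃ C, ∃ t₀ > 0, ∀ t, 0 < t → t ≤ t₀ →
      (KinfSigned B σ F (σ * mean F + t)).toReal ≤ C * t ^ 2 := by
  have hV := variance_pos hF hne
  have habsσ : |σ| = 1 :=
    (pow_eq_one_iff_of_nonneg (abs_nonneg σ) two_ne_zero).1 (by rwa [sq_abs])
  refine ⟨8 * (B / variance F) ^ 2, variance F / (4 * B), by positivity, fun t ht htt => ?_⟩
  -- The mean is moved by `2 * t`, as the constraint on the mean is strict.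
  obtain ⟨G, hG, hm, hf, hk⟩ := exists_mean_eq_add hF hF (by simp) hV (t := σ * (2 * t)) (by
    rw [abs_mul, habsσ, one_mul, abs_of_pos (by linarith), div_le_iff₀ hV]
    rw [le_div_iff₀ (by positivity)] at htt
    linarith)
  have hσσ : σ * σ = 1 := by rw [← sq, hσ]
  refine (ENNReal.toReal_mono hf (KinfSigned_le (F := F) (σ := σ) hG (by
    rw [hm, mul_add, ← mul_assoc, hσσ]; linarith))).trans (hk.trans (le_of_eq ?_))
  have h3 : (σ * (2 * t) * B / variance F) ^ 2 = σ ^ 2 * (4 * (B / variance F) ^ 2 * t ^ 2) := by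
    ring
  rw [h3, hσ]
  simp
  ring

theorem isCostProfile_KinfSigned (hB : 0 < B) (hσ : σ ^ 2 = 1) (he : e ∈ Set.Icc 0 B)
    (hF : F ∈ boundedClass B) (hlt : σ * mean F < σ * e) :
    IsCostProfile (fun u => (KinfSigned B σ F u).toReal) (σ * mean F) (σ * e) where
  lt := hlt
  nonneg _ := ENNReal.toReal_nonneg
  mono huv hv := ENNReal.toReal_mono (KinfSigned_ne_top he hF hv) (KinfSigned_mono huv)
  eq_zero hu := toReal_KinfSigned_eq_zero he hF hlt hu
  pos h h' := toReal_KinfSigned_pos hB hσ he hF h h'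
  sub_le h h' := toReal_KinfSigned_sub_le he hF h h'
  chord_le h h' h'' := toReal_KinfSigned_chord_le he hF h h' h''
  second_difference_le h h' := toReal_KinfSigned_second_difference_le hB hσ he hF h h'

end Signed

/-! ### Transportation costs of a pair of arms -/

/-- The real transportation cost of two arms: `a` is the cost of lowering the mean of the better
arm to `u`, `b` the cost of raising the mean of the other arm to `u`, and `x`, `y` are the
weights. Only the levels `u` between the two means matter. -/
noncomputable def pairCost (a b : ℝ → ℝ) (l r x y : ℝ) : ℝ :=
  sInf ((fun u => x * a u + y * b u) '' Set.Icc l r)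

/-- Two arms with means `l < r`, both costs being cost profiles, that of the better arm after
reflection. The profiles live on the half-lines below `Ea` and `Eb`. -/
structure IsTransportPair (a b : ℝ → ℝ) (l r Ea Eb : ℝ) : Prop where
  left : IsCostProfile (fun u => a (-u)) (-r) Ea
  right : IsCostProfile b l Eb
  lt : l < r
  neg_lt : -l < Ea
  lt_right : r < Eb

namespace IsTransportPair

variable {a b : ℝ → ℝ} {l r Ea Eb : ℝ}

theorem continuousOn_left (h : IsTransportPair a b l r Ea Eb) : ContinuousOn a (Set.Icc l r) := by
  have h1 := h.left.continuousOn.comp (continuous_neg.continuousOn (s := Set.Icc l r))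
    fun u hu => Set.mem_Iio.2 ((neg_le_neg hu.1).trans_lt h.neg_lt)
  refine h1.congr fun u _ => ?_
  simp

theorem continuousOn_right (h : IsTransportPair a b l r Ea Eb) : ContinuousOn b (Set.Icc l r) :=
  h.right.continuousOn.mono fun _ hu => Set.mem_Iio.2 (hu.2.trans_lt h.lt_right)

theorem left_nonneg (h : IsTransportPair a b l r Ea Eb) (u : ℝ) : 0 ≤ a u := by
  simpa using h.left.nonneg (-u)

theorem left_eq_zero (h : IsTransportPair a b l r Ea Eb) {u : ℝ} (hu : r ≤ u) : a u = 0 := by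
  simpa using h.left.eq_zero (neg_le_neg hu)

theorem left_pos (h : IsTransportPair a b l r Ea Eb) {u : ℝ} (hu : l ≤ u) (hur : u < r) :
    0 < a u := by
  simpa using h.left.pos (neg_lt_neg hur) ((neg_le_neg hu).trans_lt h.neg_lt)

theorem right_pos (h : IsTransportPair a b l r Ea Eb) {u : ℝ} (hu : l < u) (hur : u ≤ r) :
    0 < b u := h.right.pos hu (hur.trans_lt h.lt_right)

/-- The chord inequality forces the cost of the better arm to decrease at a linear rate. -/
theorem exists_left_add_le (h : IsTransportPair a b l r Ea Eb) {u : ℝ} (hu : l ≤ u)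
    (hur : u < r) : ∃ s > 0, ∀ t, 0 < t → u + t < r → a (u + t) ≤ a u - s * t := by
  have hru := sub_pos.2 hur
  refine ⟨a u / (r - u), div_pos (h.left_pos hu hur) hru, fun t ht htr => ?_⟩
  have h1 := h.left.chord_le (u := -u) (θ := t / (r - u)) ((neg_le_neg hu).trans_lt h.neg_lt)
    (by positivity) (by rw [div_lt_one hru]; linarith)
  have h2 : -((1 - t / (r - u)) * -u + t / (r - u) * -r) = u + t := by field_simp; ring
  rw [h2, neg_neg] at h1
  refine h1.trans (le_of_eq ?_)
  field_simp

theorem exists_pairCost_eq (h : IsTransportPair a b l r Ea Eb) (x y : ℝ) :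
    ∃ u ∈ Set.Icc l r, pairCost a b l r x y = x * a u + y * b u := by
  have hc : ContinuousOn (fun u => x * a u + y * b u) (Set.Icc l r) :=
    (continuousOn_const.mul h.continuousOn_left).add
      (continuousOn_const.mul h.continuousOn_right)
  exact isCompact_Icc.exists_sInf_image_eq (Set.nonempty_Icc.2 h.lt.le) hc

theorem pairCost_le (h : IsTransportPair a b l r Ea Eb) {x y : ℝ} (hx : 0 ≤ x) (hy : 0 ≤ y)
    {u : ℝ} (hu : u ∈ Set.Icc l r) : pairCost a b l r x y ≤ x * a u + y * b u := by
  refine csInf_le ⟨0, ?_⟩ (Set.mem_image_of_mem _ hu)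
  rintro _ ⟨v, _, rfl⟩
  exact add_nonneg (mul_nonneg hx (h.left_nonneg v)) (mul_nonneg hy (h.right.nonneg v))

theorem le_pairCost_iff (h : IsTransportPair a b l r Ea Eb) {x y c : ℝ} (hx : 0 ≤ x)
    (hy : 0 ≤ y) :
    c ≤ pairCost a b l r x y ↔ ∀ u ∈ Set.Icc l r, c ≤ x * a u + y * b u := by
  constructor
  · exact fun hc u hu => hc.trans (h.pairCost_le hx hy hu)
  · intro hc
    obtain ⟨u, hu, he⟩ := h.exists_pairCost_eq x y
    exact he ▸ hc u hu

theorem pairCost_nonneg (h : IsTransportPair a b l r Ea Eb) {x y : ℝ} (hx : 0 ≤ x)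
    (hy : 0 ≤ y) : 0 ≤ pairCost a b l r x y :=
  (h.le_pairCost_iff hx hy).2 fun v _ =>
    add_nonneg (mul_nonneg hx (h.left_nonneg v)) (mul_nonneg hy (h.right.nonneg v))

theorem pairCost_mono (h : IsTransportPair a b l r Ea Eb) {x y x' y' : ℝ} (hx : 0 ≤ x)
    (hy : 0 ≤ y) (hxx : x ≤ x') (hyy : y ≤ y') :
    pairCost a b l r x y ≤ pairCost a b l r x' y' := by
  refine (h.le_pairCost_iff (hx.trans hxx) (hy.trans hyy)).2 fun u hu => ?_
  have h1 := mul_le_mul_of_nonneg_right hxx (h.left_nonneg u)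
  have h2 := mul_le_mul_of_nonneg_right hyy (h.right.nonneg u)
  linarith [h.pairCost_le hx hy hu]

theorem mul_pairCost_le (h : IsTransportPair a b l r Ea Eb) {x y s : ℝ} (hx : 0 ≤ x)
    (hy : 0 ≤ y) (hs : 0 ≤ s) :
    s * pairCost a b l r x y ≤ pairCost a b l r (s * x) (s * y) := by
  refine (h.le_pairCost_iff (mul_nonneg hs hx) (mul_nonneg hs hy)).2 fun u hu => ?_
  have := mul_le_mul_of_nonneg_left (h.pairCost_le hx hy hu) hs
  linarith

theorem pairCost_zero_right (h : IsTransportPair a b l r Ea Eb) {x : ℝ} (hx : 0 ≤ x) :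
    pairCost a b l r x 0 = 0 := by
  refine le_antisymm ?_ (h.pairCost_nonneg hx le_rfl)
  have := h.pairCost_le hx le_rfl (Set.right_mem_Icc.2 h.lt.le)
  simpa [h.left_eq_zero le_rfl] using this

theorem pairCost_zero_left (h : IsTransportPair a b l r Ea Eb) {y : ℝ} (hy : 0 ≤ y) :
    pairCost a b l r 0 y = 0 := by
  refine le_antisymm ?_ (h.pairCost_nonneg le_rfl hy)
  have := h.pairCost_le le_rfl hy (Set.left_mem_Icc.2 h.lt.le)
  simpa [h.right.eq_zero le_rfl] using this

theorem pairCost_pos (h : IsTransportPair a b l r Ea Eb) {x y : ℝ} (hx : 0 < x) (hy : 0 < y) :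
    0 < pairCost a b l r x y := by
  obtain ⟨u, hu, he⟩ := h.exists_pairCost_eq x y
  rw [he]
  rcases hu.2.lt_or_eq with hur | rfl
  · exact add_pos_of_pos_of_nonneg (mul_pos hx (h.left_pos hu.1 hur))
      (mul_nonneg hy.le (h.right.nonneg u))
  · exact add_pos_of_nonneg_of_pos (mul_nonneg hx.le (h.left_nonneg u))
      (mul_pos hy (h.right_pos h.lt le_rfl))

/-- The midpoint case of concavity. -/
theorem le_pairCost_midpoint (h : IsTransportPair a b l r Ea Eb) {x y x' y' c : ℝ} (hx : 0 ≤ x)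
    (hy : 0 ≤ y) (hx' : 0 ≤ x') (hy' : 0 ≤ y') (hc : c ≤ pairCost a b l r x y)
    (hc' : c ≤ pairCost a b l r x' y') :
    c ≤ pairCost a b l r ((x + x') / 2) ((y + y') / 2) := by
  refine (h.le_pairCost_iff (by positivity) (by positivity)).2 fun u hu => ?_
  have h1 := hc.trans (h.pairCost_le hx hy hu)
  have h2 := hc'.trans (h.pairCost_le hx' hy' hu)
  linarith

/-- If the cost of the challenger is at most quadratic just beyond its mean, the minimising level
is never that mean, so the cost is strictly increasing in the weight of the challenger. -/
theorem pairCost_lt_of_lt (h : IsTransportPair a b l r Ea Eb)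
    (hq : ∃ C, ∃ t₀ > 0, ∀ t, 0 < t → t ≤ t₀ → b (l + t) ≤ C * t ^ 2) {x y y' : ℝ} (hx : 0 < x)
    (hy : 0 ≤ y) (hyy : y < y') : pairCost a b l r x y < pairCost a b l r x y' := by
  obtain ⟨u, hu, he⟩ := h.exists_pairCost_eq x y'
  have hy' := hy.trans_lt hyy
  rcases hu.1.lt_or_eq with hlu | rfl
  · have h1 := mul_lt_mul_of_pos_right hyy (h.right_pos hlu hu.2)
    linarith [h.pairCost_le hx.le hy hu]
  exfalso
  obtain ⟨C, t₀, ht₀, hC⟩ := hq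
  obtain ⟨s, hs, hsa⟩ := h.exists_left_add_le le_rfl h.lt
  have hb0 := h.right.eq_zero le_rfl
  have hxs := mul_pos hx hs
  have hlr := sub_pos.2 h.lt
  -- A step so short that the quadratic increase is below the linear gain.
  obtain ⟨t, ht, h1, h2, h3⟩ : ∃ t > 0, t ≤ t₀ ∧ t ≤ (r - l) / 2 ∧
      t ≤ x * s / (2 * (y' * |C| + 1)) :=
    ⟨min t₀ (min ((r - l) / 2) (x * s / (2 * (y' * |C| + 1)))), by positivity, min_le_left _ _,
      (min_le_right _ _).trans (min_le_left _ _), (min_le_right _ _).trans (min_le_right _ _)⟩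
  rw [le_div_iff₀ (by positivity)] at h3
  have h4 := h.pairCost_le hx.le hy'.le (u := l + t) ⟨by linarith, by linarith⟩
  rw [he, hb0] at h4
  have h5 := mul_le_mul_of_nonneg_left (hsa t ht (by linarith)) hx.le
  have h6 := mul_le_mul_of_nonneg_left (hC t ht h1) hy'.le
  have h7 : y' * (C * t ^ 2) ≤ y' * |C| * t * t := by
    have : C * t ^ 2 ≤ |C| * t ^ 2 := by gcongr; exact le_abs_self C
    have := mul_le_mul_of_nonneg_left this hy'.le
    linarith
  have h8 : y' * |C| * t < x * s := by
    have : 0 ≤ y' * |C| * t := by positivity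
    linarith
  have h9 := mul_lt_mul_of_pos_right h8 ht
  linarith

/-- Two weight pairs, neither dominating the other, cannot both reach the level `c` when their
midpoint does not exceed it: a minimising level of the midpoint would minimise both weighted costs
at an interior level. In the absence of kinks the two first-order conditions there would make the
weight pairs proportional. -/
theorem not_pairCost_midpoint_le (h : IsTransportPair a b l r Ea Eb) {x y x' y' c : ℝ}
    (hc : 0 < c) (hx : 0 ≤ x) (hy' : 0 ≤ y') (hxx : x < x') (hyy : y' < y)
    (h1 : c ≤ pairCost a b l r x y) (h2 : c ≤ pairCost a b l r x' y') :
    ¬ pairCost a b l r ((x + x') / 2) ((y + y') / 2) ≤ c := by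
  intro hmid
  have hx' := hx.trans hxx.le
  have hy := hy'.trans hyy.le
  replace hx : 0 < x := lt_of_le_of_ne hx fun h0 => by
    rw [← h0, h.pairCost_zero_left hy] at h1; linarith
  replace hy' : 0 < y' := lt_of_le_of_ne hy' fun h0 => by
    rw [← h0, h.pairCost_zero_right hx'] at h2; linarith
  replace h1 := (h.le_pairCost_iff hx.le hy).1 h1
  replace h2 := (h.le_pairCost_iff hx' hy'.le).1 h2
  obtain ⟨u, hu, he⟩ := h.exists_pairCost_eq ((x + x') / 2) ((y + y') / 2)
  have e1 : x * a u + y * b u = c := by linarith [h1 u hu, h2 u hu]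
  have e2 : x' * a u + y' * b u = c := by linarith [h1 u hu, h2 u hu]
  have hau : 0 < a u := by
    refine lt_of_le_of_ne (h.left_nonneg u) fun h0 => ?_
    rw [← h0] at e1 e2
    have : (y - y') * b u = 0 := by linarith
    rcases mul_eq_zero.1 this with h3 | h3
    · linarith
    · rw [h3] at e1; linarith
  have hbu : 0 < b u := by
    refine lt_of_le_of_ne (h.right.nonneg u) fun h0 => ?_
    rw [← h0] at e1 e2
    have : (x' - x) * a u = 0 := by linarith
    rcases mul_eq_zero.1 this with h3 | h3 <;> linarith
  have hur : u < r := not_le.1 fun h3 => hau.ne' (h.left_eq_zero h3)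
  have hlu : l < u := not_le.1 fun h3 => hbu.ne' (h.right.eq_zero h3)
  obtain ⟨C₁, t₁, ht₁, hC₁⟩ := h.left.second_difference_le (neg_lt_neg hur)
    ((neg_lt_neg hlu).trans h.neg_lt)
  obtain ⟨C₂, t₂, ht₂, hC₂⟩ := h.right.second_difference_le hlu (hur.trans h.lt_right)
  obtain ⟨s, hs, hsa⟩ := h.exists_left_add_le hlu.le hur
  have hD : 0 < y * x' - y' * x := by nlinarith
  set D := y * x' - y' * x with hDdef
  set P := y' * (x * C₁ + y * C₂) with hP
  have hDs := mul_pos hD hs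
  have hru := sub_pos.2 hur
  have hul := sub_pos.2 hlu
  -- A step so short that the quadratic error is below the first-order discrepancy.
  obtain ⟨t, ht, k1, k2, k3, k4, k5⟩ : ∃ t > 0, t ≤ t₁ ∧ t ≤ t₂ ∧ t ≤ (r - u) / 2 ∧ t ≤ u - l ∧
      t ≤ D * s / (2 * (|P| + 1)) :=
    ⟨min t₁ (min t₂ (min ((r - u) / 2) (min (u - l) (D * s / (2 * (|P| + 1)))))), by positivity,
      by simp, by simp, by simp, by simp, by simp⟩
  rw [le_div_iff₀ (by positivity)] at k5
  have d1 := hC₁ t ht k1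
  have d2 := hC₂ t ht k2
  have n1 : -(-u + t) = u - t := by ring
  have n2 : -(-u - t) = u + t := by ring
  simp only [n1, n2, neg_neg] at d1
  have d3 := hsa t ht (by linarith)
  have f1 := h1 (u - t) ⟨by linarith, by linarith⟩
  have f2 := h2 (u + t) ⟨by linarith, by linarith⟩
  set A := a u - a (u + t) with hA
  have g1 : y * (b (u + t) - b u) ≤ (x * C₁ + y * C₂) * t ^ 2 + x * A := by
    have i1 := mul_le_mul_of_nonneg_left d1 hx.le
    have i2 := mul_le_mul_of_nonneg_left d2 hy
    linarith
  have g2 : x' * A ≤ y' * (b (u + t) - b u) := by linarith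
  have g3 := mul_le_mul_of_nonneg_left g1 hy'.le
  have g4 := mul_le_mul_of_nonneg_left g2 hy
  have g5 : D * A ≤ P * t ^ 2 := by rw [hDdef, hP]; linarith
  have g6 : D * (s * t) ≤ D * A := mul_le_mul_of_nonneg_left (by linarith) hD.le
  have g7 : P * t ^ 2 ≤ |P| * t * t := by
    have : P * t ^ 2 ≤ |P| * t ^ 2 := by gcongr; exact le_abs_self P
    linarith
  have g8 : |P| * t < D * s := by
    have : 0 ≤ |P| * t := by positivity
    linarith
  have g9 := mul_lt_mul_of_pos_right g8 ht
  linarith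

end IsTransportPair

/-! ### Optimal allocations -/

section Allocation

variable {ι : Type*} [Fintype ι] [DecidableEq ι] {star : ι} {a : ℝ → ℝ} {b : ι → ℝ → ℝ}
  {l : ι → ℝ} {r Ea Eb : ℝ}

/-- If no weight can be saved at level `c` without changing the weight of `star`, then every
challenger attains exactly the level `c`: weight could be taken from one that exceeds it. -/
theorem pairCost_eq_of_one_le_sum (h : ∀ i ≠ star, IsTransportPair a (b i) (l i) r Ea Eb)
    {w : ι → ℝ} (hw : w ∈ stdSimplex ℝ ι) {c : ℝ} (hc : 0 < c)
    (hle : ∀ i ≠ star, c ≤ pairCost a (b i) (l i) r (w star) (w i))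
    (hsum : ∀ v : ι → ℝ, (∀ i, 0 ≤ v i) → v star = w star →
      (∀ i ≠ star, c ≤ pairCost a (b i) (l i) r (v star) (v i)) → 1 ≤ ∑ i, v i)
    {i : ι} (hi : i ≠ star) : pairCost a (b i) (l i) r (w star) (w i) = c := by
  refine le_antisymm (not_lt.1 fun hlt => ?_) (hle i hi)
  set p := pairCost a (b i) (l i) r (w star) (w i) with hp
  have hp0 : 0 < p := hc.trans hlt
  have hwi : 0 < w i := lt_of_le_of_ne (hw.1 i) fun h0 => by
    rw [hp, ← h0, (h i hi).pairCost_zero_right (hw.1 star)] at hp0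
    exact lt_irrefl _ hp0
  have hs0 : 0 < c / p := div_pos hc hp0
  have hs1 : c / p < 1 := (div_lt_one hp0).2 hlt
  have h1 := hsum (Function.update w i (c / p * w i)) (fun j => by
      rcases eq_or_ne j i with rfl | hj
      · simpa using (mul_pos hs0 hwi).le
      · simpa [hj] using hw.1 j) (by simp [hi.symm]) (fun j hj => by
      rw [Function.update_of_ne hi.symm]
      rcases eq_or_ne j i with rfl | hji
      · rw [Function.update_self]
        calc c = c / p * p := by field_simp
          _ ≤ pairCost a (b j) (l j) r (c / p * w star) (c / p * w j) :=
            (h j hj).mul_pairCost_le (hw.1 star) (hw.1 j) hs0.le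
          _ ≤ _ := (h j hj).pairCost_mono (mul_nonneg hs0.le (hw.1 star))
            (mul_nonneg hs0.le (hw.1 j)) (mul_le_of_le_one_left (hw.1 star) hs1.le) le_rfl
      · rw [Function.update_of_ne hji]
        exact hle j hj)
  rw [Finset.sum_update_of_mem (Finset.mem_univ i)] at h1
  have h2 := hw.2
  rw [← Finset.add_sum_erase _ _ (Finset.mem_univ i), ← Finset.sdiff_singleton_eq_erase] at h2
  nlinarith

omit [DecidableEq ι] in
/-- If no weight can be saved at level `c`, an allocation reaching that level is determined by the
weight of `star`: the pointwise minimum of two such allocations reaches the level as well. -/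
theorem eq_of_one_le_sum {w w' : ι → ℝ} (hw : w ∈ stdSimplex ℝ ι)
    (hw' : w' ∈ stdSimplex ℝ ι) (hstar : w star = w' star) {c : ℝ}
    (hle : ∀ i ≠ star, c ≤ pairCost a (b i) (l i) r (w star) (w i))
    (hle' : ∀ i ≠ star, c ≤ pairCost a (b i) (l i) r (w' star) (w' i))
    (hsum : ∀ v : ι → ℝ, (∀ i, 0 ≤ v i) → v star = w star →
      (∀ i ≠ star, c ≤ pairCost a (b i) (l i) r (v star) (v i)) → 1 ≤ ∑ i, v i) :
    w = w' := by
  have h1 := hsum (fun i => min (w i) (w' i)) (fun i => le_min (hw.1 i) (hw'.1 i))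
    (by simp [hstar]) (fun i hi => by
      have h0 : min (w star) (w' star) = w star := by simp [hstar]
      simp only [h0]
      rcases min_choice (w i) (w' i) with h2 | h2
      · rw [h2]; exact hle i hi
      · rw [h2, hstar]; exact hle' i hi)
  have key : ∀ v : ι → ℝ, v ∈ stdSimplex ℝ ι → (∀ i, min (w i) (w' i) ≤ v i) →
      ∀ i, min (w i) (w' i) = v i := by
    intro v hv hle i
    have h2 := le_antisymm (Finset.sum_le_sum fun i _ => hle i) (hv.2.trans_le h1)
    exact (Finset.sum_eq_sum_iff_of_le fun i _ => hle i).1 h2 i (Finset.mem_univ i)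
  funext i
  rw [← key w hw (fun i => min_le_left _ _) i, key w' hw' (fun i => min_le_right _ _) i]

variable (star a b l r)

/-- The real objective: the smallest transportation cost over the challengers. -/
noncomputable def minPairCost (hne : (Finset.univ.erase star).Nonempty) (w : ι → ℝ) : ℝ :=
  (Finset.univ.erase star).inf' hne fun i => pairCost a (b i) (l i) r (w star) (w i)

variable {star a b l r} {hne : (Finset.univ.erase star).Nonempty}

theorem le_minPairCost_iff {w : ι → ℝ} {c : ℝ} :
    c ≤ minPairCost star a b l r hne w ↔
      ∀ i ≠ star, c ≤ pairCost a (b i) (l i) r (w star) (w i) := by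
  simp [minPairCost, Finset.le_inf'_iff]

theorem minPairCost_le (w : ι → ℝ) {i : ι} (hi : i ≠ star) :
    minPairCost star a b l r hne w ≤ pairCost a (b i) (l i) r (w star) (w i) :=
  le_minPairCost_iff.1 le_rfl i hi

theorem lt_minPairCost_iff {w : ι → ℝ} {c : ℝ} :
    c < minPairCost star a b l r hne w ↔
      ∀ i ≠ star, c < pairCost a (b i) (l i) r (w star) (w i) := by
  simp [minPairCost, Finset.lt_inf'_iff]

/-- The objective is an infimum of linear functions of the allocation. -/
theorem upperSemicontinuousOn_minPairCost
    (h : ∀ i ≠ star, IsTransportPair a (b i) (l i) r Ea Eb) :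
    UpperSemicontinuousOn (minPairCost star a b l r hne) (stdSimplex ℝ ι) := by
  intro w hw y hy
  obtain ⟨i, hi, he⟩ := Finset.exists_mem_eq_inf' hne
    fun i => pairCost a (b i) (l i) r (w star) (w i)
  have hi' := Finset.ne_of_mem_erase hi
  obtain ⟨u, hu, hue⟩ := (h i hi').exists_pairCost_eq (w star) (w i)
  have hlt : w star * a u + w i * b i u < y := by
    rw [← hue, ← he]; exact hy
  have hcont : Continuous fun v : ι → ℝ => v star * a u + v i * b i u := by fun_prop
  filter_upwards [self_mem_nhdsWithin,
    nhdsWithin_le_nhds (hcont.continuousAt.eventually_lt_const hlt)] with v hv hvlt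
  exact (minPairCost_le v hi').trans_lt
    (((h i hi').pairCost_le (hv.1 star) (hv.1 i) hu).trans_lt hvlt)

/-- The allocation with weight `β` on `star` and equal weights on the challengers. -/
theorem exists_mem_stdSimplex_pos (hne : (Finset.univ.erase star).Nonempty) {β : ℝ}
    (hβ : β ∈ Set.Ioo (0 : ℝ) 1) :
    ∃ w ∈ stdSimplex ℝ ι, w star = β ∧ ∀ i, 0 < w i := by
  have hcard : (0 : ℝ) < (Finset.univ.erase star).card := by exact_mod_cast hne.card_pos
  have h1 := sub_pos.2 hβ.2
  set v : ι → ℝ := fun i => if i = star then β else (1 - β) / (Finset.univ.erase star).card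
    with hv
  have hpos : ∀ i, 0 < v i := by
    intro i
    simp only [hv]
    split_ifs
    · exact hβ.1
    · positivity
  refine ⟨v, ⟨fun i => (hpos i).le, ?_⟩, by simp [hv], hpos⟩
  rw [← Finset.add_sum_erase _ _ (Finset.mem_univ star),
    Finset.sum_congr rfl (g := fun _ => (1 - β) / (Finset.univ.erase star).card)
      fun i hi => if_neg (Finset.ne_of_mem_erase hi)]
  simp only [hv, if_true, Finset.sum_const, nsmul_eq_mul]
  field_simp
  ring

theorem minPairCost_pos (h : ∀ i ≠ star, IsTransportPair a (b i) (l i) r Ea Eb) {w : ι → ℝ}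
    (hw : ∀ i, 0 < w i) : 0 < minPairCost star a b l r hne w :=
  lt_minPairCost_iff.2 fun i hi => (h i hi).pairCost_pos (hw star) (hw i)

/-- Over the whole simplex no weight can be saved at the optimal level, by homogeneity of the
costs. -/
theorem one_le_sum_of_isMaxOn_stdSimplex
    (h : ∀ i ≠ star, IsTransportPair a (b i) (l i) r Ea Eb) {w : ι → ℝ}
    (hpos : 0 < minPairCost star a b l r hne w)
    (hmax : IsMaxOn (minPairCost star a b l r hne) (stdSimplex ℝ ι) w) {v : ι → ℝ}
    (hv : ∀ i, 0 ≤ v i)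
    (hle : ∀ i ≠ star, minPairCost star a b l r hne w ≤
      pairCost a (b i) (l i) r (v star) (v i)) : 1 ≤ ∑ i, v i := by
  by_contra! hlt
  have hvs : 0 < v star := lt_of_le_of_ne (hv star) fun h0 => by
    obtain ⟨i, hi⟩ := hne
    have hi' := Finset.ne_of_mem_erase hi
    have := hle i hi'
    rw [← h0, (h i hi').pairCost_zero_left (hv i)] at this
    linarith
  have hs : 0 < ∑ i, v i :=
    hvs.trans_le (Finset.single_le_sum (fun i _ => hv i) (Finset.mem_univ star))
  set s := (∑ i, v i)⁻¹ with hsdef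
  have hs0 : 0 < s := inv_pos.2 hs
  have hs1 : 1 < s := (one_lt_inv₀ hs).2 hlt
  have hmem : (fun i => s * v i) ∈ stdSimplex ℝ ι :=
    ⟨fun i => mul_nonneg hs0.le (hv i), by
      rw [← Finset.mul_sum, hsdef, inv_mul_cancel₀ hs.ne']⟩
  refine absurd (hmax hmem) (not_le.2 (lt_minPairCost_iff.2 fun i hi => ?_))
  refine lt_of_lt_of_le ?_ ((h i hi).mul_pairCost_le (hv star) (hv i) hs0.le)
  nlinarith [hle i hi]

/-- With the weight of `star` prescribed, no weight can be saved at the optimal level if the costs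
increase strictly with the weights of the challengers. -/
theorem one_le_sum_of_isMaxOn_of_lt
    (h : ∀ i ≠ star, ∀ x y y', 0 < x → 0 ≤ y → y < y' →
      pairCost a (b i) (l i) r x y < pairCost a (b i) (l i) r x y')
    {w : ι → ℝ} {β : ℝ} (hβ : 0 < β)
    (hmax : IsMaxOn (minPairCost star a b l r hne) {w | w ∈ stdSimplex ℝ ι ∧ w star = β} w)
    {v : ι → ℝ} (hv : ∀ i, 0 ≤ v i) (hvs : v star = β)
    (hle : ∀ i ≠ star, minPairCost star a b l r hne w ≤
      pairCost a (b i) (l i) r (v star) (v i)) : 1 ≤ ∑ i, v i := by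
  by_contra! hlt
  have hcard : (0 : ℝ) < (Finset.univ.erase star).card := by exact_mod_cast hne.card_pos
  have hgap := sub_pos.2 hlt
  set δ := (1 - ∑ i, v i) / (Finset.univ.erase star).card with hδ
  have hδ0 : 0 < δ := by positivity
  set v' : ι → ℝ := fun i => if i = star then β else v i + δ with hv'
  have hv's : v' star = β := by simp [hv']
  have hmem : v' ∈ stdSimplex ℝ ι := by
    refine ⟨fun i => ?_, ?_⟩
    · simp only [hv']
      split_ifs
      · exact hβ.le
      · linarith [hv i]
    · rw [← Finset.add_sum_erase _ _ (Finset.mem_univ star),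
        Finset.sum_congr rfl (g := fun i => v i + δ)
          fun i hi => if_neg (Finset.ne_of_mem_erase hi),
        Finset.sum_add_distrib, Finset.sum_const, nsmul_eq_mul, hδ, mul_div_cancel₀ _ hcard.ne',
        hv's, ← hvs, ← Finset.add_sum_erase _ _ (Finset.mem_univ star)]
      ring
  refine absurd (hmax ⟨hmem, hv's⟩) (not_le.2 (lt_minPairCost_iff.2 fun i hi => ?_))
  refine (hle i hi).trans_lt ?_
  rw [hv's, hvs]
  have : v' i = v i + δ := if_neg hi
  rw [this]
  exact h i hi β (v i) (v i + δ) hβ (hv i) (by linarith)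

/-- Existence, uniqueness and equality of the costs for the maximiser over the simplex. -/
theorem exists_unique_isMaxOn_stdSimplex
    (h : ∀ i ≠ star, IsTransportPair a (b i) (l i) r Ea Eb) :
    ∃ w ∈ stdSimplex ℝ ι, IsMaxOn (minPairCost star a b l r hne) (stdSimplex ℝ ι) w ∧
      (∀ i ≠ star, pairCost a (b i) (l i) r (w star) (w i) = minPairCost star a b l r hne w) ∧
      ∀ w' ∈ stdSimplex ℝ ι, IsMaxOn (minPairCost star a b l r hne) (stdSimplex ℝ ι) w' →
        w' = w := by
  obtain ⟨w₀, hw₀, -, hw₀pos⟩ := exists_mem_stdSimplex_pos hne (β := 1 / 2) (by norm_num)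
  have hpos : ∀ w, IsMaxOn (minPairCost star a b l r hne) (stdSimplex ℝ ι) w →
      0 < minPairCost star a b l r hne w := fun w hw =>
    (minPairCost_pos h hw₀pos).trans_le (hw hw₀)
  obtain ⟨w, hw, hmax⟩ := (upperSemicontinuousOn_minPairCost (hne := hne) h).exists_isMaxOn
    ⟨w₀, hw₀⟩ (isCompact_stdSimplex ℝ ι)
  have heq : ∀ w ∈ stdSimplex ℝ ι, IsMaxOn (minPairCost star a b l r hne) (stdSimplex ℝ ι) w →
      ∀ i ≠ star, pairCost a (b i) (l i) r (w star) (w i) = minPairCost star a b l r hne w :=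
    fun w hw hmax i hi => pairCost_eq_of_one_le_sum h hw (hpos w hmax)
      (fun i hi => minPairCost_le w hi)
      (fun v hv _ hle => one_le_sum_of_isMaxOn_stdSimplex h (hpos w hmax) hmax hv hle) hi
  refine ⟨w, hw, hmax, heq w hw hmax, fun w' hw' hmax' => ?_⟩
  have hval : ∀ {w w'}, w ∈ stdSimplex ℝ ι → w' ∈ stdSimplex ℝ ι →
      IsMaxOn (minPairCost star a b l r hne) (stdSimplex ℝ ι) w →
      IsMaxOn (minPairCost star a b l r hne) (stdSimplex ℝ ι) w' →
      minPairCost star a b l r hne w = minPairCost star a b l r hne w' :=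
    fun hw hw' hmax hmax' => le_antisymm (hmax' hw) (hmax hw')
  -- Two maximisers give the same weight to `star`.
  have hno : ∀ w ∈ stdSimplex ℝ ι, ∀ w' ∈ stdSimplex ℝ ι,
      IsMaxOn (minPairCost star a b l r hne) (stdSimplex ℝ ι) w →
      IsMaxOn (minPairCost star a b l r hne) (stdSimplex ℝ ι) w' → ¬ w star < w' star := by
    intro w hw w' hw' hmax hmax' hlt
    obtain ⟨i, hi, hwi⟩ : ∃ i ≠ star, w' i < w i := by
      by_contra! hcon
      refine absurd (hw.2.trans hw'.2.symm) (ne_of_lt (Finset.sum_lt_sum (fun i _ => ?_)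
        ⟨star, Finset.mem_univ star, hlt⟩))
      rcases eq_or_ne i star with rfl | hi
      · exact hlt.le
      · exact hcon i hi
    set m : ι → ℝ := fun i => (w i + w' i) / 2 with hm
    have hmm : m ∈ stdSimplex ℝ ι := by
      refine ⟨fun i => div_nonneg (add_nonneg (hw.1 i) (hw'.1 i)) zero_le_two, ?_⟩
      simp only [hm]
      rw [← Finset.sum_div, Finset.sum_add_distrib, hw.2, hw'.2]
      norm_num
    have hwm : minPairCost star a b l r hne w ≤ minPairCost star a b l r hne m :=
      le_minPairCost_iff.2 fun j hj => (h j hj).le_pairCost_midpoint (hw.1 star) (hw.1 j)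
        (hw'.1 star) (hw'.1 j) (minPairCost_le w hj)
        ((hval hw hw' hmax hmax').le.trans (minPairCost_le w' hj))
    have hmaxm : IsMaxOn (minPairCost star a b l r hne) (stdSimplex ℝ ι) m :=
      fun v hv => (hmax hv).trans hwm
    exact (h i hi).not_pairCost_midpoint_le (hpos w hmax) (hw.1 star) (hw'.1 i) hlt hwi
      (minPairCost_le w hi) ((hval hw hw' hmax hmax').le.trans (minPairCost_le w' hi))
      ((heq m hmm hmaxm i hi).trans (hval hmm hw hmaxm hmax)).le
  have hstar : w star = w' star := le_antisymm (not_lt.1 (hno w' hw' w hw hmax' hmax))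
    (not_lt.1 (hno w hw w' hw' hmax hmax'))
  exact (eq_of_one_le_sum hw hw' hstar (fun i hi => minPairCost_le w hi)
    (fun i hi => (hval hw hw' hmax hmax').le.trans (minPairCost_le w' hi))
    (fun v hv _ hle => one_le_sum_of_isMaxOn_stdSimplex h (hpos w hmax) hmax hv hle)).symm

/-- The same for the maximiser among the allocations with a prescribed weight of `star`, when the
costs increase strictly with the weights of the challengers. -/
theorem exists_unique_isMaxOn_of_lt
    (h : ∀ i ≠ star, IsTransportPair a (b i) (l i) r Ea Eb)
    (hlt : ∀ i ≠ star, ∀ x y y', 0 < x → 0 ≤ y → y < y' →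
      pairCost a (b i) (l i) r x y < pairCost a (b i) (l i) r x y')
    {β : ℝ} (hβ : β ∈ Set.Ioo (0 : ℝ) 1) {S : Set (ι → ℝ)}
    (hS : S = {w | w ∈ stdSimplex ℝ ι ∧ w star = β}) :
    ∃ w ∈ S, IsMaxOn (minPairCost star a b l r hne) S w ∧
      (∀ i ≠ star, pairCost a (b i) (l i) r (w star) (w i) = minPairCost star a b l r hne w) ∧
      ∀ w' ∈ S, IsMaxOn (minPairCost star a b l r hne) S w' → w' = w := by
  subst hS
  obtain ⟨w₀, hw₀, hw₀β, hw₀pos⟩ := exists_mem_stdSimplex_pos hne hβ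
  have hcomp : IsCompact {w : ι → ℝ | w ∈ stdSimplex ℝ ι ∧ w star = β} :=
    (isCompact_stdSimplex ℝ ι).inter_right
      (isClosed_eq (continuous_apply star) continuous_const)
  obtain ⟨w, hw, hmax⟩ := UpperSemicontinuousOn.exists_isMaxOn
    (Set.nonempty_of_mem (Set.mem_ofPred.2 ⟨hw₀, hw₀β⟩)) hcomp
    ((upperSemicontinuousOn_minPairCost (hne := hne) h).mono fun w hw => hw.1)
  have hpos : 0 < minPairCost star a b l r hne w :=
    (minPairCost_pos h hw₀pos).trans_le (hmax ⟨hw₀, hw₀β⟩)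
  have hsum : ∀ v : ι → ℝ, (∀ i, 0 ≤ v i) → v star = w star →
      (∀ i ≠ star, minPairCost star a b l r hne w ≤ pairCost a (b i) (l i) r (v star) (v i)) →
      1 ≤ ∑ i, v i := fun v hv hvs hle =>
    one_le_sum_of_isMaxOn_of_lt hlt hβ.1 hmax hv (hvs.trans hw.2) hle
  refine ⟨w, hw, hmax, fun i hi => pairCost_eq_of_one_le_sum h hw.1 hpos
    (fun i hi => minPairCost_le w hi) hsum hi, fun w' hw' hmax' => ?_⟩
  exact (eq_of_one_le_sum hw.1 hw'.1 (hw.2.trans hw'.2.symm) (fun i hi => minPairCost_le w hi)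
    (fun i hi => (hmax' hw).trans (minPairCost_le w' hi)) hsum).symm

end Allocation

/-! ### From divergences to real costs -/

section Reduction

variable {B : ℝ} {K : ℕ} {F : Fin K → ProbabilityMeasure ℝ} {istar i : Fin K}

theorem isTransportPair_Kinf (hB : 0 < B) (hF : ∀ i, F i ∈ boundedClass B)
    (hmean : ∀ i, mean (F i) ∈ Set.Ioo 0 B) (hlt : mean (F i) < mean (F istar)) :
    IsTransportPair (fun u => (KinfMinus (boundedClass B) (F istar) u).toReal)
      (fun u => (KinfPlus (boundedClass B) (F i) u).toReal) (mean (F i)) (mean (F istar)) 0 B where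
  left := by
    have h := isCostProfile_KinfSigned (σ := -1) (e := 0) hB (by norm_num)
      (Set.left_mem_Icc.2 hB.le) (hF istar) (by linarith [(hmean istar).1])
    simpa [KinfMinus_eq_KinfSigned] using h
  right := by
    have h := isCostProfile_KinfSigned (σ := 1) (e := B) hB (by norm_num)
      (Set.right_mem_Icc.2 hB.le) (hF i) (by linarith [(hmean i).2])
    simpa [KinfPlus_eq_KinfSigned] using h
  lt := hlt
  neg_lt := by linarith [(hmean i).1]
  lt_right := (hmean istar).2

theorem KinfMinus_ne_top (hF : ∀ i, F i ∈ boundedClass B) {u : ℝ} (hB : 0 < B) (hu : 0 < u) :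
    KinfMinus (boundedClass B) (F i) u ≠ ∞ := by
  rw [KinfMinus_eq_KinfSigned]
  exact KinfSigned_ne_top (e := 0) (Set.left_mem_Icc.2 hB.le) (hF i) (by linarith)

theorem KinfPlus_ne_top (hF : ∀ i, F i ∈ boundedClass B) {u : ℝ} (hB : 0 < B) (hu : u < B) :
    KinfPlus (boundedClass B) (F i) u ≠ ∞ := by
  rw [KinfPlus_eq_KinfSigned]
  exact KinfSigned_ne_top (e := B) (Set.right_mem_Icc.2 hB.le) (hF i) (by linarith)

/-- The transportation cost is the real one: a level outside the interval between the two means is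
no better than the nearer of the two means, and in the interval all costs are finite. -/
theorem transportCost_eq_ofReal_pairCost (hB : 0 < B) (hF : ∀ i, F i ∈ boundedClass B)
    (hmean : ∀ i, mean (F i) ∈ Set.Ioo 0 B) (hlt : mean (F i) < mean (F istar))
    {w : Fin K → ℝ} (hw : ∀ i, 0 ≤ w i) :
    transportCost B F w istar i = ENNReal.ofReal
      (pairCost (fun u => (KinfMinus (boundedClass B) (F istar) u).toReal)
        (fun u => (KinfPlus (boundedClass B) (F i) u).toReal) (mean (F i)) (mean (F istar))
        (w istar) (w i)) := by
  have h := isTransportPair_Kinf (istar := istar) hB hF hmean hlt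
  have hml := hmean i
  have hmr := hmean istar
  have hreal : ∀ u ∈ Set.Icc (mean (F i)) (mean (F istar)),
      ENNReal.ofReal (w istar) * KinfMinus (boundedClass B) (F istar) u +
        ENNReal.ofReal (w i) * KinfPlus (boundedClass B) (F i) u =
      ENNReal.ofReal (w istar * (KinfMinus (boundedClass B) (F istar) u).toReal +
        w i * (KinfPlus (boundedClass B) (F i) u).toReal) := by
    intro u hu
    rw [ENNReal.ofReal_add (mul_nonneg (hw _) ENNReal.toReal_nonneg)
      (mul_nonneg (hw _) ENNReal.toReal_nonneg), ENNReal.ofReal_mul (hw _),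
      ENNReal.ofReal_mul (hw _),
      ENNReal.ofReal_toReal (KinfMinus_ne_top hF hB (hml.1.trans_le hu.1)),
      ENNReal.ofReal_toReal (KinfPlus_ne_top hF hB (hu.2.trans_lt hmr.2))]
  apply le_antisymm
  · obtain ⟨u, hu, he⟩ := h.exists_pairCost_eq (w istar) (w i)
    rw [he, ← hreal u hu]
    exact iInf₂_le u ⟨hml.1.le.trans hu.1, hu.2.trans hmr.2.le⟩
  · refine le_iInf₂ fun u _ => ?_
    -- Replace `u` by its projection `v` onto the interval between the means.
    obtain ⟨v, hv, hvm, hvp⟩ : ∃ v ∈ Set.Icc (mean (F i)) (mean (F istar)),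
        KinfMinus (boundedClass B) (F istar) v ≤ KinfMinus (boundedClass B) (F istar) u ∧
        KinfPlus (boundedClass B) (F i) v ≤ KinfPlus (boundedClass B) (F i) u := by
      rcases le_total u (mean (F i)) with hul | hul
      · refine ⟨mean (F i), Set.left_mem_Icc.2 hlt.le, ?_, ?_⟩
        · rw [KinfMinus_eq_KinfSigned, KinfMinus_eq_KinfSigned]
          exact KinfSigned_mono (neg_le_neg hul)
        · have h0 := h.right.eq_zero le_rfl
          rw [((ENNReal.toReal_eq_zero_iff _).1 h0).resolve_right
            (KinfPlus_ne_top hF hB hml.2)]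
          exact zero_le
      rcases le_total u (mean (F istar)) with hur | hur
      · exact ⟨u, ⟨hul, hur⟩, le_rfl, le_rfl⟩
      · refine ⟨mean (F istar), Set.right_mem_Icc.2 hlt.le, ?_, ?_⟩
        · have h0 := h.left_eq_zero le_rfl
          rw [((ENNReal.toReal_eq_zero_iff _).1 h0).resolve_right
            (KinfMinus_ne_top hF hB hmr.1)]
          exact zero_le
        · rw [KinfPlus_eq_KinfSigned, KinfPlus_eq_KinfSigned]
          exact KinfSigned_mono hur
    refine (ENNReal.ofReal_le_ofReal (h.pairCost_le (hw istar) (hw i) hv)).trans ?_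
    rw [← hreal v hv]
    gcongr

theorem minTransportCost_eq_ofReal_minPairCost (hB : 0 < B) (hF : ∀ i, F i ∈ boundedClass B)
    (hmean : ∀ i, mean (F i) ∈ Set.Ioo 0 B)
    (hlt : ∀ i, i ≠ istar → mean (F i) < mean (F istar))
    (hne : (Finset.univ.erase istar).Nonempty) {w : Fin K → ℝ} (hw : ∀ i, 0 ≤ w i) :
    minTransportCost B F istar w = ENNReal.ofReal
      (minPairCost istar (fun u => (KinfMinus (boundedClass B) (F istar) u).toReal)
        (fun i u => (KinfPlus (boundedClass B) (F i) u).toReal) (fun i => mean (F i))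
        (mean (F istar)) hne w) := by
  apply le_antisymm
  · obtain ⟨i, hi, he⟩ := Finset.exists_mem_eq_inf' hne fun i =>
      pairCost (fun u => (KinfMinus (boundedClass B) (F istar) u).toReal)
        (fun u => (KinfPlus (boundedClass B) (F i) u).toReal) (mean (F i)) (mean (F istar))
        (w istar) (w i)
    have hi' := Finset.ne_of_mem_erase hi
    rw [minPairCost, he, ← transportCost_eq_ofReal_pairCost hB hF hmean (hlt i hi') hw]
    exact iInf₂_le i hi'
  · refine le_iInf₂ fun i hi => ?_
    rw [transportCost_eq_ofReal_pairCost hB hF hmean (hlt i hi) hw]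
    exact ENNReal.ofReal_le_ofReal (minPairCost_le w hi)

/-- Transfer of existence, uniqueness and equality of the costs from the real objective to the
extended one. -/
theorem exists_unique_isMaxOn_minTransportCost (hB : 0 < B) (hF : ∀ i, F i ∈ boundedClass B)
    (hmean : ∀ i, mean (F i) ∈ Set.Ioo 0 B)
    (hlt : ∀ i, i ≠ istar → mean (F i) < mean (F istar))
    (hne : (Finset.univ.erase istar).Nonempty) {S : Set (Fin K → ℝ)}
    (hS : S ⊆ stdSimplex ℝ (Fin K)) {f : (Fin K → ℝ) → ℝ}
    (hf : f = minPairCost istar (fun u => (KinfMinus (boundedClass B) (F istar) u).toReal)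
      (fun i u => (KinfPlus (boundedClass B) (F i) u).toReal) (fun i => mean (F i))
      (mean (F istar)) hne)
    (h : ∃ w ∈ S, IsMaxOn f S w ∧
      (∀ i ≠ istar, pairCost (fun u => (KinfMinus (boundedClass B) (F istar) u).toReal)
        (fun u => (KinfPlus (boundedClass B) (F i) u).toReal) (mean (F i)) (mean (F istar))
        (w istar) (w i) = f w) ∧ ∀ w' ∈ S, IsMaxOn f S w' → w' = w) :
    ∃ w : Fin K → ℝ, {w | w ∈ S ∧ IsMaxOn (minTransportCost B F istar) S w} = {w} ∧
      ∀ i, i ≠ istar →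
        transportCost B F w istar i = ⨆ w ∈ S, minTransportCost B F istar w := by
  obtain ⟨w, hw, hmax, heq, huniq⟩ := h
  have hval : ∀ v ∈ S, minTransportCost B F istar v = ENNReal.ofReal (f v) := fun v hv => by
    rw [hf]
    exact minTransportCost_eq_ofReal_minPairCost hB hF hmean hlt hne (hS hv).1
  have hnonneg : ∀ v ∈ S, 0 ≤ f v := fun v hv => by
    rw [hf]
    exact le_minPairCost_iff.2 fun i hi =>
      (isTransportPair_Kinf hB hF hmean (hlt i hi)).pairCost_nonneg ((hS hv).1 _) ((hS hv).1 _)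
  have hiff : ∀ v ∈ S, IsMaxOn (minTransportCost B F istar) S v ↔ IsMaxOn f S v := by
    intro v hv
    simp only [isMaxOn_iff]
    refine forall₂_congr fun x hx => ?_
    rw [hval x hx, hval v hv, ENNReal.ofReal_le_ofReal_iff (hnonneg v hv)]
  refine ⟨w, ?_, fun i hi => ?_⟩
  · ext v
    constructor
    · rintro ⟨hv, hvmax⟩
      exact huniq v hv ((hiff v hv).1 hvmax)
    · rintro rfl
      exact ⟨hw, (hiff v hw).2 hmax⟩
  · rw [transportCost_eq_ofReal_pairCost hB hF hmean (hlt i hi) (hS hw).1, heq i hi, ← hval w hw]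
    exact le_antisymm (le_iSup₂ (f := fun v (_ : v ∈ S) => minTransportCost B F istar v) w hw)
      (iSup₂_le fun v hv => (hiff w hw).2 hmax hv)

end Reduction

end BestArm

theorem mainTheorem6 (B : ℝ) (hB : 0 < B) (K : ℕ) (hK : 2 ≤ K)
    (F : Fin K → MeasureTheory.ProbabilityMeasure ℝ)
    (hF : ∀ i, F i ∈ BestArm.boundedClass B)
    (hmean : ∀ i, BestArm.mean (F i) ∈ Set.Ioo 0 B)
    (istar : Fin K) (hbest : BestArm.bestArms F = {istar}) :
    (∃ w : Fin K → ℝ, BestArm.optAlloc B F istar = {w} ∧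
      ∀ i, i ≠ istar →
        BestArm.transportCost B F w istar i = (BestArm.charTime B F istar)⁻¹) ∧
    ((∀ i, i ≠ istar → ∀ x : ℝ,
        (F i : MeasureTheory.Measure ℝ) ≠ MeasureTheory.Measure.dirac x) →
      ∀ β ∈ Set.Ioo (0 : ℝ) 1,
        ∃ w : Fin K → ℝ, BestArm.optAllocWith B F istar β = {w} ∧
          ∀ i, i ≠ istar →
            BestArm.transportCost B F w istar i = (BestArm.charTimeWith B F istar β)⁻¹) := by
  have hstar : ∀ j, BestArm.mean (F j) ≤ BestArm.mean (F istar) := by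
    have : istar ∈ BestArm.bestArms F := by rw [hbest]; rfl
    exact this
  have hlt : ∀ i, i ≠ istar → BestArm.mean (F i) < BestArm.mean (F istar) := by
    intro i hi
    by_contra! hle
    have : i ∈ BestArm.bestArms F := fun j => (hstar j).trans hle
    rw [hbest] at this
    exact hi this
  have hne : (Finset.univ.erase istar).Nonempty := by
    rw [← Finset.card_pos, Finset.card_erase_of_mem (Finset.mem_univ _), Finset.card_univ,
      Fintype.card_fin]
    omega
  have hpair := fun i (hi : i ≠ istar) => BestArm.isTransportPair_Kinf hB hF hmean (hlt i hi)
  refine ⟨?_, fun hdirac β hβ => ?_⟩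
  · rw [BestArm.charTime, inv_inv]
    exact BestArm.exists_unique_isMaxOn_minTransportCost hB hF hmean hlt hne subset_rfl rfl
      (BestArm.exists_unique_isMaxOn_stdSimplex (hne := hne) hpair)
  · rw [BestArm.charTimeWith, inv_inv]
    refine BestArm.exists_unique_isMaxOn_minTransportCost hB hF hmean hlt hne (fun w hw => hw.1)
      rfl (BestArm.exists_unique_isMaxOn_of_lt (hne := hne) hpair
        (fun i hi x y y' hx hy hyy => (hpair i hi).pairCost_lt_of_lt ?_ hx hy hyy) hβ rfl)
    have h := BestArm.toReal_KinfSigned_mean_add_le (σ := 1) (by norm_num) (hF i)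
      (hdirac i hi) hB
    simpa [BestArm.KinfPlus_eq_KinfSigned] using h
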